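/- Let $q\ge 2$, $Q=\{0,\dots,q-1\}$ and $n\ge 0$. A local rule $f:Q^n\to Q$ and an offset $d\in\mathbb Z$ define the cellular automaton $F_{f,d}$ on $Q^{\mathbb Z}$ by $F_{f,d}(c)_{i+d}=f(c_i,\dots,c_{i+n-1})$. The rule $f$ is conservative if $\sum_{k=0}^{p-1}F_{f,d}(c)_k=\sum_{k=0}^{p-1}c_k$ for every configuration $c$ of period $p>0$ (this does not depend on $d$). A particle automaton $G$ with states $Q$ and neighborhood $\{-L,\dots,R\}$ ($L,R\ge 0$) consists of functions $g_s:Q^L\times Q^R\to(\{-L,\dots,R\}\cup\{\dagger\})^s$ for $s=1,\dots,q-1$. The $k$-th of the $c_j$ particles at cell $j$ of a configuration $c$ vanishes if $[g_{c_j}(c_{j-L},\dots,c_{j-1},c_{j+1},\dots,c_{j+R})]_k=\dagger$, and otherwise moves to $j+[g_{c_j}(c_{j-L},\dots,c_{j-1},c_{j+1},\dots,c_{j+R})]_k$; $G(c)_i$ is the minimum of $q-1$ and the number of particles that arrive at (or stay in) cell $i$. $G$ has anticipation if, for some configuration $c$ and cell $i$, the number $t$ of particles that cell $i$ receives from other cells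 satisfies $t+c_i>q-1$. A cellular automaton $F$ is the projection of $G$ if $F(c)=G(c)$ for all $c\in Q^{\mathbb Z}$. The code of $f$ is the triple $(q,n,\mathrm{Code}(f))$ with $\mathrm{Code}(f)=\sum_{x\in Q^n}f(x)\,q^{\sum_{k=1}^n q^{n-k}x_k}$, and a particle automaton is given as a finite object by $L$, $R$ and the table of its functions $g_s$. **Theorem.** 1. If $f$ is conservative and $F_{f,d}$ is the projection of a particle automaton without anticipation, then $$d=\frac1{q-1}\sum_{i=1}^{n-1}f(\underbrace{0,\dots,0}_{i},\underbrace{q-1,\dots,q-1}_{n-i}).$$ 2. There is an algorithm that decides, given the code of a conservative rule $f$, whether there is a $d\in\mathbb Z$ such that $F_{f,d}$ is the projection of a particle automaton without anticipation. 3. There is an algorithm that, given the code of a conservative rule $f$ for which such a $d$ exists, computes this $d$ and a particle automaton $G$ without anticipation such that $F_{f,d}$ is the projection of $G$. Moreover $d=\ell$ with $0\le\ell\le n-1$ and, with $r=n-1-\ell$ and $t=2\max\{\ell,r\}$, the neighborhood of $G$ is $\{-L_1-\ell,\dots,R_1+r\}$, where $$L_1=r(q-1)(t+1)q^t,\qquad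 R_1=\ell(q-1)(t+1)q^t.$$ -/

import Mathlib

namespace ParticleCA

open Finset

/-- Configurations: bi-infinite sequences over the set of states `{0, …, q-1}`. -/
abbrev Config (q : ℕ) := ℤ → Fin q

/-- Local rules with `q` states and a neighborhood of `n` consecutive cells. -/
abbrev Rule (q n : ℕ) := (Fin n → Fin q) → Fin q

/-- The word `c_a c_{a+1} … c_{a+m-1}`. -/
def window {q : ℕ} (c : Config q) (a : ℤ) (m : ℕ) : Fin m → Fin q :=
  fun k => c (a + (k : ℕ))

/-- The number with base-`q` expansion `x_1 x_2 … x_m` (most significant digit first). -/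
def wordIndex {q m : ℕ} (x : Fin m → Fin q) : ℕ :=
  ∑ k : Fin m, q ^ (m - 1 - (k : ℕ)) * (x k : ℕ)

/-- The cellular automaton with local rule `f` and offset `d`:
`F(c)_{i+d} = f(c_i, …, c_{i+n-1})`. -/
def Rule.toCA {q n : ℕ} (f : Rule q n) (d : ℤ) (c : Config q) : Config q :=
  fun i => f (window c (i - d) n)

/-- The sum of the states over a period of any periodic configuration is conserved by `F`. -/
def Conserves {q : ℕ} (F : Config q → Config q) : Prop :=
  ∀ (c : Config q) (p : ℕ), 0 < p → (∀ i : ℤ, c (i + (p : ℤ)) = c i) →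
    ∑ k ∈ range p, (F c (k : ℤ) : ℕ) = ∑ k ∈ range p, (c (k : ℤ) : ℕ)

/-- Conservative local rules. The offset is immaterial, see `Rule.isConservative_iff`. -/
def Rule.IsConservative {q n : ℕ} (f : Rule q n) : Prop := Conserves (f.toCA 0)

theorem sum_period_shift (g : ℤ → ℕ) (p : ℕ) (hg : ∀ i : ℤ, g (i + (p : ℤ)) = g i) (a : ℤ) :
    ∑ k ∈ range p, g ((k : ℤ) + a) = ∑ k ∈ range p, g (k : ℤ) := by
  have step : ∀ b : ℤ, ∑ k ∈ range p, g ((k : ℤ) + (b + 1)) = ∑ k ∈ range p, g ((k : ℤ) + b) := by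
    intro b
    have h1 := Finset.sum_range_succ (fun k : ℕ => g ((k : ℤ) + b)) p
    have h2 := Finset.sum_range_succ' (fun k : ℕ => g ((k : ℤ) + b)) p
    have h3 : g ((p : ℤ) + b) = g b := by rw [add_comm, hg]
    have h4 : ∀ k : ℕ, ((k : ℤ) + (b + 1)) = (((k + 1 : ℕ) : ℤ) + b) := by
      intro k; push_cast; ring
    simp only [h4]
    simp only [Nat.cast_zero, zero_add] at h2
    omega
  induction a using Int.induction_on with
  | zero => simp
  | succ i ih => rw [step, ih]
  | pred i ih =>
    rw [← ih, ← step]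
    simp

theorem Rule.isConservative_iff {q n : ℕ} (f : Rule q n) (d : ℤ) :
    Conserves (f.toCA d) ↔ f.IsConservative := by
  have key : ∀ (e : ℤ) (c : Config q) (p : ℕ), (∀ i : ℤ, c (i + (p : ℤ)) = c i) →
      ∑ k ∈ range p, (f.toCA e c (k : ℤ) : ℕ) = ∑ k ∈ range p, (f.toCA 0 c (k : ℤ) : ℕ) := by
    intro e c p hc
    have h := sum_period_shift (fun i => (f.toCA 0 c i : ℕ)) p (by
      intro i
      have hw : window c (i + (p : ℤ) - 0) n = window c (i - 0) n := by
        funext k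
        have := hc (i - 0 + (k : ℕ))
        simp only [window]
        rw [← this]
        congr 1
        ring
      simp only [Rule.toCA, hw]) (-e)
    rw [← h]
    refine Finset.sum_congr rfl fun k _ => ?_
    simp only [Rule.toCA, sub_eq_add_neg, neg_zero, add_zero]
  constructor
  · intro h c p hp hc
    rw [← key d c p hc]
    exact h c p hp hc
  · intro h c p hp hc
    rw [key d c p hc]
    exact h c p hp hc

/-- Wolfram's code of a local rule, `∑_x f(x) q ^ (∑_k q^(n-k) x_k)`. -/
def Rule.code {q n : ℕ} (f : Rule q n) : ℕ :=
  ∑ x : Fin n → Fin q, (f x : ℕ) * q ^ wordIndex x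

/-- A particle automaton with `q` states and neighborhood `{-L, …, R}`: for a cell in state `s`
that sees the words `u` on its left and `v` on its right, `move s u v` lists what its `s` particles
do. A particle vanishes (`none`) or moves by a displacement in `{-L, …, R}`. -/
structure PA (q : ℕ) where
  L : ℕ
  R : ℕ
  move : (s : Fin q) → (Fin L → Fin q) → (Fin R → Fin q) →
    Fin (s : ℕ) → Option (Set.Icc (-(L : ℤ)) (R : ℤ))

namespace PA

variable {q : ℕ}

/-- The new position of the `k`-th particle at cell `j` of `c` (`none` if it vanishes). -/
def dest (G : PA q) (c : Config q) (j : ℤ) (k : Fin (c j : ℕ)) : Option ℤ :=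
  (G.move (c j) (window c (j - (G.L : ℤ)) G.L) (window c (j + 1) G.R) k).map
    fun z => j + z.val

/-- The particles `(j, k)` of `c` that arrive at cell `i` (including those that stay there). -/
def arrivals (G : PA q) (c : Config q) (i : ℤ) : Set (Σ j : ℤ, Fin (c j : ℕ)) :=
  {p | G.dest c p.1 p.2 = some i}

/-- The global action: the number of particles arriving at each cell, cut off at `q - 1`. -/
noncomputable def act (G : PA q) (c : Config q) : Config q := fun i =>
  ⟨min (q - 1) (G.arrivals c i).ncard, by have := (c i).isLt; omega⟩

/-- Some cell in a state `s` receives from other cells `t` particles with `t + s > q - 1`. -/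
def Anticipates (G : PA q) : Prop :=
  ∃ (c : Config q) (i : ℤ), q - 1 < {p ∈ G.arrivals c i | p.1 ≠ i}.ncard + (c i : ℕ)

/-- The particle automaton with neighborhood `{-L, …, R}` described by a lookup table: the entry
whose index is the number with base-`q` digits `u s v` lists the targets of the `s` particles,
`none` for vanishing, and `some m` for the `m`-th cell of the neighborhood, `0 ≤ m ≤ L + R`. -/
def ofTable (q L R : ℕ) (T : List (List (Option ℕ))) : PA q where
  L := L
  R := R
  move := fun s u v k =>
    ((T.getD (wordIndex u * q ^ (R + 1) + (s : ℕ) * q ^ R + wordIndex v) []).getD k none).bind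
      fun m => if h : m ≤ L + R then
        some ⟨(m : ℤ) - L, by constructor <;> omega⟩ else none

end PA

/-- `F` is a projection of the particle automaton `G`. -/
def IsProjection {q : ℕ} (F : Config q → Config q) (G : PA q) : Prop :=
  ∀ c : Config q, F c = G.act c

/-- The CA with local rule `f` and offset `d` is the projection of some particle automaton
without anticipation. -/
def Rule.AvoidsAnticipation {q n : ℕ} (f : Rule q n) (d : ℤ) : Prop :=
  ∃ G : PA q, ¬ G.Anticipates ∧ IsProjection (f.toCA d) G

/-- The word `0^i (q-1)^(n-i)`. -/
def stepWord {q : ℕ} (hq : 2 ≤ q) (n i : ℕ) : Fin n → Fin q :=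
  fun k => if (k : ℕ) < i then ⟨0, by omega⟩ else ⟨q - 1, by omega⟩

/-- The number `(q-1) (t+1) q^t`, where `t = 2 max {ℓ, r}`. -/
def reach (q ℓ r : ℕ) : ℕ :=
  (q - 1) * (2 * max ℓ r + 1) * q ^ (2 * max ℓ r)

end ParticleCA

/-!
Write `n = ℓ + r + 1` and let `F` be the cellular automaton with rule `f` and offset `ℓ`. In a
conservative automaton the particles have a flow: `flow f c i`, the net number of particles that
cross the cut before cell `i` from left to right, is a function of the `ℓ` cells to the left and
the `r` cells to the right of the cut. It satisfies the continuity equation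
(`Rule.IsConservative.flow_succ`) and is at most `ℓ (q - 1)` to the right and `r (q - 1)` to the
left (`Rule.IsConservative.flow_le`, `Rule.IsConservative.le_flow`).

Consider a particle automaton without anticipation that realizes `F`. A cell in state `q - 1`
receives nothing and a cell that becomes `0` receives nothing, so that no particle moves in a fixed
configuration whose cells are all in state `0` or `q - 1`, and its flow must vanish
(`IsProjection.leftSum_eq_zero`). The configuration with all cells in state `q - 1` gives the
formula for the offset (`Rule.AvoidsAnticipation.offset_mul`). More generally, say that a cell is
blocked for reception if `F(c)_j = 0` or `c_j = q - 1`, and blocked for emission if `c_j = 0` or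
`F(c)_j = q - 1`. If a periodic configuration is everywhere blocked for reception, then
`F(c) ≤ c` cell by cell, and conservation makes it a fixed configuration with states `0` and
`q - 1`; similarly for emission. By the pigeonhole principle a long blocked region contains a part
that can be repeated periodically. Hence a region of `blockLength q ℓ r` blocked cells must contain
a cut without flow (`Rule.AvoidsAnticipation.unblocked`).

Conversely, this condition is sufficient. Let cell `j` emit `min (c_j) (q - 1 - F(c)_j)` particles
and receive `min (F(c)_j) (q - 1 - c_j)` particles. This has the correct balance and does not
anticipate; all that remains is to match the emitted with the received particles. They are matched
in the order-preserving way with the given flow. A particle on its way to the right crosses only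
cuts with a positive flow, so that every `blockLength q ℓ r` cells on its way receive at least one
of the at most `ℓ (q - 1)` particles that are ahead of it. This bounds its path
(`exists_destination`), and the destination can be computed from the neighborhood of the required
size (`Unblocked.transportTable_spec`).

The condition concerns finitely many words and is therefore decidable (`Criterion`). Words are
represented by the numbers of which they are the base-`q` digits, and then the criterion, the offset
and the table of the particle automaton become primitive recursive functions of the code of the
rule.
-/

namespace ParticleCA

open Finset Filter

/-! ### Words as numbers -/

theorem sum_digits_div_mod {q : ℕ} (K : ℕ) :
    ∀ (g : ℕ → ℕ), (∀ v, g v < q) → ∀ i < K, (∑ v ∈ range K, g v * q ^ v) / q ^ i % q = g i := by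
  induction K with
  | zero => intro g _ i hi; omega
  | succ K ih =>
    intro g hg i hi
    have hq : 0 < q := by have := hg 0; omega
    have h : ∑ v ∈ range (K + 1), g v * q ^ v = g 0 + q * ∑ v ∈ range K, g (v + 1) * q ^ v := by
      rw [Finset.sum_range_succ', Finset.mul_sum, add_comm]
      congr 1
      · simp
      · exact Finset.sum_congr rfl fun v _ => by ring
    rw [h]
    cases i with
    | zero => simp [Nat.add_mul_mod_self_left, Nat.mod_eq_of_lt (hg 0)]
    | succ i =>
      rw [pow_succ', ← Nat.div_div_eq_div_mul, Nat.add_mul_div_left _ _ hq,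
        Nat.div_eq_of_lt (hg 0), zero_add]
      exact ih (fun v => g (v + 1)) (fun v => hg _) i (by omega)

theorem wordIndex_succ {q m : ℕ} (x : Fin (m + 1) → Fin q) :
    wordIndex x = (x 0 : ℕ) * q ^ m + wordIndex (fun k : Fin m => x k.succ) := by
  simp only [wordIndex, Fin.sum_univ_succ]
  congr 1
  · simp [mul_comm]
  · refine Finset.sum_congr rfl fun k _ => ?_
    congr 2
    simp only [Fin.val_succ]
    omega

theorem wordIndex_lt {q m : ℕ} (x : Fin m → Fin q) : wordIndex x < q ^ m := by
  induction m with
  | zero => simp [wordIndex]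
  | succ m ih =>
    rw [wordIndex_succ]
    have h1 := ih fun k : Fin m => x k.succ
    have h2 := (x 0).isLt
    calc _ < (x 0 : ℕ) * q ^ m + q ^ m := by omega
      _ = ((x 0 : ℕ) + 1) * q ^ m := by ring
      _ ≤ q * q ^ m := Nat.mul_le_mul_right _ h2
      _ = q ^ (m + 1) := by ring

theorem wordIndex_injective {q m : ℕ} :
    Function.Injective (wordIndex : (Fin m → Fin q) → ℕ) := by
  induction m with
  | zero => intro x y _; exact Subsingleton.elim _ _
  | succ m ih =>
    intro x y h
    rw [wordIndex_succ, wordIndex_succ] at h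
    have h1 := wordIndex_lt fun k : Fin m => x k.succ
    have h2 := wordIndex_lt fun k : Fin m => y k.succ
    have hpos : 0 < q ^ m := by omega
    have h3 : (x 0 : ℕ) = y 0 := by
      have := congrArg (· / q ^ m) h
      simpa [Nat.add_div_of_dvd_right (Dvd.intro_left _ rfl), Nat.mul_div_cancel _ hpos,
        Nat.div_eq_of_lt h1, Nat.div_eq_of_lt h2] using this
    have h4 := ih (a₁ := fun k : Fin m => x k.succ) (a₂ := fun k : Fin m => y k.succ)
      (by rw [h3] at h; omega)
    funext k
    refine Fin.cases (Fin.ext h3) (fun k => congrFun h4 k) k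

theorem exists_wordIndex_eq {q m v : ℕ} (hv : v < q ^ m) :
    ∃ x : Fin m → Fin q, wordIndex x = v := by
  have hinj : Function.Injective
      (fun x : Fin m → Fin q => (⟨wordIndex x, wordIndex_lt x⟩ : Fin (q ^ m))) :=
    fun x y h => wordIndex_injective (by simpa using h)
  obtain ⟨x, hx⟩ := ((Fintype.bijective_iff_injective_and_card _).2 ⟨hinj, by simp⟩).2 ⟨v, hv⟩
  exact ⟨x, by simpa using hx⟩

/-- The value, on the word with index `v`, of the local rule with Wolfram code `C`. -/
def lookup (q C v : ℕ) : ℕ := C / q ^ v % q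

/-- The digits of Wolfram's code are the values of the local rule. -/
theorem lookup_code {q n : ℕ} (f : Rule q n) (x : Fin n → Fin q) :
    lookup q f.code (wordIndex x) = f x := by
  classical
  have hq : 0 < q := (f x).pos
  let g : ℕ → ℕ := fun v => if h : v < q ^ n then f (exists_wordIndex_eq h).choose else 0
  have hg : ∀ y : Fin n → Fin q, g (wordIndex y) = f y := by
    intro y
    have h := wordIndex_lt y
    simp only [g, h, dif_pos]
    rw [wordIndex_injective (exists_wordIndex_eq h).choose_spec]
  have hcode : f.code = ∑ v ∈ range (q ^ n), g v * q ^ v := by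
    refine Finset.sum_bij (fun y _ => wordIndex y) (fun y _ => mem_range.2 (wordIndex_lt y))
      (fun y _ z _ h => wordIndex_injective h) (fun v hv => ?_) (fun y _ => by rw [hg])
    obtain ⟨y, hy⟩ := exists_wordIndex_eq (mem_range.1 hv)
    exact ⟨y, mem_univ _, hy⟩
  rw [lookup, hcode, sum_digits_div_mod _ g _ _ (wordIndex_lt x), hg]
  intro v
  simp only [g]
  split
  · exact Fin.isLt _
  · exact hq

theorem lookup_lt {q : ℕ} (hq : 0 < q) (C v : ℕ) : lookup q C v < q := Nat.mod_lt _ hq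

/-- The number whose base-`q` digits are the states of the `m` cells of `c` that start at `a`. -/
def wnum {q : ℕ} (c : Config q) (a : ℤ) (m : ℕ) : ℕ := wordIndex (window c a m)

theorem wnum_lt {q : ℕ} (c : Config q) (a : ℤ) (m : ℕ) : wnum c a m < q ^ m := wordIndex_lt _

theorem wnum_one {q : ℕ} (c : Config q) (a : ℤ) : wnum c a 1 = c a := by
  simp [wnum, wordIndex, window]

theorem wnum_add {q : ℕ} (c : Config q) (a : ℤ) (A B : ℕ) :
    wnum c a (A + B) = wnum c a A * q ^ B + wnum c (a + A) B := by
  simp only [wnum, wordIndex, Fin.sum_univ_add, window, Finset.sum_mul]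
  congr 1
  · refine Finset.sum_congr rfl fun k _ => ?_
    have : A + B - 1 - (k : ℕ) = (A - 1 - k) + B := by have := k.isLt; omega
    simp only [Fin.val_castAdd, this, pow_add]
    ring
  · refine Finset.sum_congr rfl fun k _ => ?_
    have : A + B - 1 - (A + (k : ℕ)) = B - 1 - k := by omega
    simp only [Fin.val_natAdd, this]
    push_cast
    rw [add_assoc]

theorem wnum_congr {q : ℕ} {c c' : Config q} {a : ℤ} {m : ℕ}
    (h : ∀ j, a ≤ j → j < a + m → c j = c' j) : wnum c a m = wnum c' a m := by
  simp only [wnum]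
  congr 1
  funext k
  exact h _ (by omega) (by have := k.isLt; omega)

theorem wnum_div {q : ℕ} (c : Config q) (a : ℤ) (A B : ℕ) :
    wnum c a (A + B) / q ^ B = wnum c a A := by
  have h := wnum_lt c (a + A) B
  rw [wnum_add, Nat.add_div_of_dvd_right (Dvd.intro_left _ rfl), Nat.div_eq_of_lt h,
    Nat.mul_div_cancel _ (by omega), add_zero]

theorem wnum_mod {q : ℕ} (c : Config q) (a : ℤ) (A B : ℕ) :
    wnum c a (A + B) % q ^ B = wnum c (a + A) B := by
  rw [wnum_add, Nat.mul_add_mod', Nat.mod_eq_of_lt (wnum_lt _ _ _)]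

/-- The number of a subword of length `B`, which has `A` cells before it and `D` after it. -/
theorem wnum_div_mod {q : ℕ} (c : Config q) (a : ℤ) (A B D : ℕ) :
    wnum c a (A + B + D) / q ^ D % q ^ B = wnum c (a + A) B := by
  rw [wnum_div, wnum_mod]

theorem wnum_div_mod_one {q : ℕ} (c : Config q) (a : ℤ) (A D : ℕ) :
    wnum c a (A + 1 + D) / q ^ D % q = c (a + A) := by
  have := wnum_div_mod c a A 1 D
  rwa [pow_one, wnum_one] at this

theorem exists_wnum_eq {q m v : ℕ} (hq : 0 < q) (a : ℤ) (hv : v < q ^ m) :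
    ∃ c : Config q, wnum c a m = v := by
  obtain ⟨x, hx⟩ := exists_wordIndex_eq hv
  refine ⟨fun j => if h : (j - a).toNat < m then x ⟨_, h⟩ else ⟨0, hq⟩, ?_⟩
  rw [← hx, wnum]
  congr 1
  funext k
  simp [window]

theorem lookup_wnum {q n : ℕ} (f : Rule q n) (d : ℤ) (c : Config q) (i : ℤ) :
    lookup q f.code (wnum c (i - d) n) = f.toCA d c i := lookup_code f _

theorem toCA_congr {q n : ℕ} (f : Rule q n) {d : ℤ} {c c' : Config q} {i : ℤ}
    (h : ∀ j, i - d ≤ j → j < i - d + n → c j = c' j) : f.toCA d c i = f.toCA d c' i := by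
  simp only [Rule.toCA]
  congr 1
  funext k
  exact h _ (by omega) (by have := k.isLt; omega)

/-! ### The flow of a conservative rule -/

theorem Rule.IsConservative.toCA_eq_of_const {q n : ℕ} {f : Rule q n} (hf : f.IsConservative)
    {d : ℤ} {c : Config q} {i : ℤ} (s : Fin q)
    (h : ∀ j, i - d ≤ j → j < i - d + n → c j = s) : f.toCA d c i = s := by
  have h1 := hf (fun _ => s) 1 one_pos (fun _ => rfl)
  rw [toCA_congr f (c' := fun _ => s) h]
  have h2 : f (window (fun _ => s) (0 - 0) n) = s := by
    apply Fin.ext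
    simpa [Rule.toCA] using h1
  exact h2

theorem Rule.IsConservative.toCA_eq_zero {q n : ℕ} {f : Rule q n} (hf : f.IsConservative)
    {d : ℤ} {c : Config q} {i : ℤ}
    (h : ∀ j, i - d ≤ j → j < i - d + n → (c j : ℕ) = 0) : (f.toCA d c i : ℕ) = 0 := by
  rw [hf.toCA_eq_of_const ⟨0, (c i).pos⟩ fun j h1 h2 => Fin.ext (h j h1 h2)]

/-- A rule that reads no cell is constant and cannot conserve two uniform configurations. -/
theorem Rule.IsConservative.pos {q n : ℕ} {f : Rule q n} (hf : f.IsConservative) (hq : 2 ≤ q) :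
    0 < n := by
  rcases Nat.eq_zero_or_pos n with rfl | h
  · have h0 := hf.toCA_eq_of_const (d := 0) (c := fun _ => ⟨0, by omega⟩) (i := 0) ⟨0, by omega⟩
      (fun _ _ _ => rfl)
    have h1 := hf.toCA_eq_of_const (d := 0) (c := fun _ => ⟨0, by omega⟩) (i := 0) ⟨1, by omega⟩
      (fun j h1 h2 => by simp at h1 h2; omega)
    rw [h0] at h1
    simp at h1
  · exact h

/-- A configuration in which all but finitely many cells are in state `0`. -/
def FinSupp {q : ℕ} (c : Config q) : Prop := ∃ K : ℕ, ∀ j : ℤ, (K : ℤ) ≤ |j| → (c j : ℕ) = 0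

/-- The number of particles that cell `j` loses. -/
def drift {q n : ℕ} (f : Rule q n) (d : ℤ) (c : Config q) (j : ℤ) : ℤ :=
  (c j : ℤ) - (f.toCA d c j : ℤ)

/-- The number of particles that the `M` cells to the left of the cut before cell `i` lose. -/
def leftSum {q n : ℕ} (f : Rule q n) (d : ℤ) (c : Config q) (i : ℤ) (M : ℕ) : ℤ :=
  ∑ s ∈ range M, drift f d c (i - 1 - s)

/-- The number of particles that the `M` cells to the right of the cut before cell `i` lose. -/
def rightSum {q n : ℕ} (f : Rule q n) (d : ℤ) (c : Config q) (i : ℤ) (M : ℕ) : ℤ :=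
  ∑ s ∈ range M, drift f d c (i + s)

/-- A finitely supported configuration is, for the purpose of one time step, one period of a
periodic one, so that its particles are conserved as well. -/
theorem Rule.IsConservative.leftSum_add_rightSum {q n : ℕ} {f : Rule q n} (hf : f.IsConservative)
    (d : ℤ) {c : Config q} (hc : FinSupp c) (i : ℤ) :
    ∀ᶠ M in atTop, leftSum f d c i M + rightSum f d c i M = 0 := by
  obtain ⟨K, hK⟩ := hc
  filter_upwards [eventually_gt_atTop (K + i.natAbs + n + d.natAbs)] with M hM
  -- One period consists of the `M` cells on either side of the cut.
  let p : ℕ := M + M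
  let c' : Config q := fun z => c ((z - (i - M)) % (p : ℤ) + (i - M))
  have hp : (0 : ℤ) < (p : ℤ) := by simp only [p]; omega
  have hper : ∀ z : ℤ, c' (z + (p : ℤ)) = c' z := by
    intro z
    simp only [c']
    congr 2
    rw [show z + (p : ℤ) - (i - M) = (z - (i - M)) + p by ring, Int.add_emod_right]
  have hin : ∀ z : ℤ, i - M ≤ z → z < i + M → c' z = c z := by
    intro z h1 h2
    simp only [c']
    rw [Int.emod_eq_of_lt (by omega) (by simp only [p]; omega)]
    congr 1
    ring
  have hout : ∀ z : ℤ, i - M - n - d.natAbs ≤ z → z ≤ i + M + n + d.natAbs → c' z = c z := by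
    intro z h1 h2
    by_cases h3 : z < i - M
    · rw [← hper, hin _ (by simp only [p]; omega) (by simp only [p]; omega)]
      apply Fin.ext
      rw [hK z (by rw [le_abs]; omega), hK (z + p) (by rw [le_abs]; simp only [p]; omega)]
    · by_cases h4 : z < i + M
      · exact hin z (by omega) h4
      · have := hper (z - p)
        rw [sub_add_cancel] at this
        rw [this, hin _ (by simp only [p]; omega) (by simp only [p]; omega)]
        apply Fin.ext
        rw [hK z (by rw [le_abs]; omega), hK (z - p) (by rw [le_abs]; simp only [p]; omega)]
  have hF : ∀ z : ℤ, i - M ≤ z → z < i + M → f.toCA d c' z = f.toCA d c z := by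
    intro z h1 h2
    exact toCA_congr f fun j h3 h4 => hout j (by omega) (by omega)
  have hFper : ∀ z : ℤ, f.toCA d c' (z + (p : ℤ)) = f.toCA d c' z := by
    intro z
    simp only [Rule.toCA]
    congr 1
    funext k
    simp only [window]
    rw [← hper (z - d + _)]
    congr 1
    ring
  have hcons := (Rule.isConservative_iff f d).2 hf c' p (by omega) hper
  rw [← sum_period_shift (fun z => (f.toCA d c' z : ℕ)) p (fun z => by rw [hFper]) (i - M),
    ← sum_period_shift (fun z => (c' z : ℕ)) p (fun z => by rw [hper]) (i - M)] at hcons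
  have hcons' : ∑ k ∈ range (M + M), drift f d c ((k : ℤ) + (i - M)) = 0 := by
    have h1 : ∀ k ∈ range (M + M), drift f d c ((k : ℤ) + (i - M)) =
        ((c' ((k : ℤ) + (i - M)) : ℕ) : ℤ) - ((f.toCA d c' ((k : ℤ) + (i - M)) : ℕ) : ℤ) := by
      intro k hk
      have := mem_range.1 hk
      rw [hF _ (by omega) (by omega), hin _ (by omega) (by omega)]
      rfl
    rw [Finset.sum_congr rfl h1, Finset.sum_sub_distrib, sub_eq_zero]
    exact_mod_cast hcons.symm
  rw [Finset.sum_range_add, ← Finset.sum_range_reflect] at hcons'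
  rw [← hcons', leftSum, rightSum]
  congr 1
  · refine Finset.sum_congr rfl fun s hs => ?_
    have := mem_range.1 hs
    congr 1
    omega
  · refine Finset.sum_congr rfl fun s _ => ?_
    congr 1
    push_cast
    ring

/-- The net loss on the left of a cut depends only on the cells that see both sides of it. -/
theorem Rule.IsConservative.leftSum_congr {q ℓ r : ℕ} {f : Rule q (ℓ + r + 1)}
    (hf : f.IsConservative) {c₁ c₂ : Config q} (h₁ : FinSupp c₁) (h₂ : FinSupp c₂) {i : ℤ}
    (h : ∀ j, i - ℓ ≤ j → j < i + r → c₁ j = c₂ j) :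
    ∀ᶠ M in atTop, leftSum f ℓ c₁ i M = leftSum f ℓ c₂ i M := by
  -- The loss on the left is the same for `c₁` and `c₃`, the loss on the right for `c₃` and `c₂`;
  -- conservation translates one into the other.
  let c₃ : Config q := fun j => if j < i then c₁ j else c₂ j
  have h₃ : FinSupp c₃ := by
    obtain ⟨K₁, hK₁⟩ := h₁
    obtain ⟨K₂, hK₂⟩ := h₂
    refine ⟨max K₁ K₂, fun j hj => ?_⟩
    simp only [c₃]
    split
    · exact hK₁ j (by omega)
    · exact hK₂ j (by omega)
  have e1 : ∀ j, j < i + r → c₃ j = c₁ j := by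
    intro j hj
    simp only [c₃]
    split
    · rfl
    · exact (h j (by omega) hj).symm
  have e2 : ∀ j, i - ℓ ≤ j → c₃ j = c₂ j := by
    intro j hj
    simp only [c₃]
    split
    · exact h j hj (by omega)
    · rfl
  filter_upwards [hf.leftSum_add_rightSum ℓ h₂ i, hf.leftSum_add_rightSum ℓ h₃ i] with M m2 m3
  have l : leftSum f ℓ c₁ i M = leftSum f ℓ c₃ i M := by
    refine Finset.sum_congr rfl fun s _ => ?_
    rw [drift, drift, e1 _ (by omega), toCA_congr f fun j _ hj => e1 j (by push_cast at hj; omega)]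
  have rr : rightSum f ℓ c₃ i M = rightSum f ℓ c₂ i M := by
    refine Finset.sum_congr rfl fun s _ => ?_
    rw [drift, drift, e2 _ (by omega), toCA_congr f fun j hj _ => e2 j (by omega)]
  omega

/-- The configuration that agrees with `c` on `{a, …, b-1}` and is `0` elsewhere. -/
def trunc {q : ℕ} (c : Config q) (a b : ℤ) : Config q :=
  fun j => if a ≤ j ∧ j < b then c j else ⟨0, (c j).pos⟩

theorem trunc_of_mem {q : ℕ} (c : Config q) {a b j : ℤ} (h1 : a ≤ j) (h2 : j < b) :
    trunc c a b j = c j := if_pos ⟨h1, h2⟩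

theorem trunc_of_lt {q : ℕ} (c : Config q) {a b j : ℤ} (h : j < a) :
    (trunc c a b j : ℕ) = 0 := by
  simp only [trunc]; rw [if_neg (by omega)]

theorem trunc_of_le {q : ℕ} (c : Config q) {a b j : ℤ} (h : b ≤ j) :
    (trunc c a b j : ℕ) = 0 := by
  simp only [trunc]; rw [if_neg (by omega)]

theorem finSupp_trunc {q : ℕ} (c : Config q) (a b : ℤ) : FinSupp (trunc c a b) := by
  refine ⟨a.natAbs + b.natAbs + 1, fun j hj => ?_⟩
  simp only [trunc]
  rw [if_neg]
  rintro ⟨h1, h2⟩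
  rw [le_abs] at hj
  omega

/-- The net number of particles that cross, from left to right, the cut before cell `i`. It is
read off the configuration in which only the cells near the cut are kept. -/
def flow {q ℓ r : ℕ} (f : Rule q (ℓ + r + 1)) (c : Config q) (i : ℤ) : ℤ :=
  leftSum f ℓ (trunc c (i - ℓ) (i + r)) i (ℓ + r)

theorem Rule.IsConservative.leftSum_eq_flow {q ℓ r : ℕ} {f : Rule q (ℓ + r + 1)}
    (hf : f.IsConservative) {c c' : Config q} (hc' : FinSupp c') {i : ℤ}
    (h : ∀ j, i - ℓ ≤ j → j < i + r → c' j = c j) :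
    ∀ᶠ M in atTop, leftSum f ℓ c' i M = flow f c i := by
  filter_upwards [eventually_ge_atTop (ℓ + r), hf.leftSum_congr hc'
    (finSupp_trunc c (i - ℓ) (i + r))
    fun j h1 h2 => (h j h1 h2).trans (trunc_of_mem c h1 h2).symm] with M hM hM'
  rw [hM', flow]
  obtain ⟨M', rfl⟩ := Nat.exists_eq_add_of_le hM
  rw [leftSum, Finset.sum_range_add, leftSum, add_eq_left]
  refine Finset.sum_eq_zero fun s _ => ?_
  rw [drift, trunc_of_lt _ (by push_cast; omega), hf.toCA_eq_zero, sub_self]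
  intro j _ hj
  exact trunc_of_lt _ (by push_cast at hj; omega)

/-- The continuity equation. -/
theorem Rule.IsConservative.flow_succ {q ℓ r : ℕ} {f : Rule q (ℓ + r + 1)}
    (hf : f.IsConservative) (c : Config q) (i : ℤ) :
    flow f c (i + 1) = flow f c i + ((c i : ℤ) - (f.toCA ℓ c i : ℤ)) := by
  let c' := trunc c (i - ℓ) (i + 1 + r)
  have hfs : FinSupp c' := finSupp_trunc _ _ _
  have e : ∀ j, i - ℓ ≤ j → j < i + 1 + r → c' j = c j := fun j h1 h2 => trunc_of_mem c h1 h2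
  have h1 := hf.leftSum_eq_flow (c := c) hfs (i := i) fun j h1 h2 => e j h1 (by omega)
  have h2 := hf.leftSum_eq_flow (c := c) hfs (i := i + 1) fun j h1 h2 => e j (by omega) h2
  obtain ⟨M, m1, m2⟩ := (h1.and ((tendsto_add_atTop_nat 1).eventually h2)).exists
  rw [← m2, ← m1, leftSum, Finset.sum_range_succ']
  have hd : drift f ℓ c' (i + 1 - 1 - (0 : ℕ)) = (c i : ℤ) - (f.toCA ℓ c i : ℤ) := by
    rw [show i + 1 - 1 - ((0 : ℕ) : ℤ) = i by simp, drift, e i (by omega) (by omega),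
      toCA_congr f (fun j h1 h2 => e j h1 (by push_cast at h2; omega))]
  rw [hd, leftSum]
  congr 1
  refine Finset.sum_congr rfl fun s _ => ?_
  congr 1
  push_cast
  ring

theorem sum_range_le_of_vanish {g : ℕ → ℤ} {b : ℤ} {k : ℕ} (h1 : ∀ s, g s ≤ b)
    (h2 : ∀ s, k ≤ s → g s = 0) {M : ℕ} (hM : k ≤ M) : ∑ s ∈ range M, g s ≤ k * b := by
  obtain ⟨M', rfl⟩ := Nat.exists_eq_add_of_le hM
  rw [Finset.sum_range_add, Finset.sum_eq_zero (s := range M') fun s _ => h2 _ (by omega), add_zero]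
  calc _ ≤ ∑ s ∈ range k, b := Finset.sum_le_sum fun s _ => h1 s
    _ = k * b := by simp

theorem toCA_sub_le {q n : ℕ} (f : Rule q n) (d : ℤ) (c c' : Config q) (i : ℤ) :
    (f.toCA d c i : ℤ) - (f.toCA d c' i : ℤ) ≤ ((q - 1 : ℕ) : ℤ) := by
  have := (f.toCA d c i).isLt
  omega

/-- Emptying the cells on the left of a cut leaves a flow that is not to the right and changes
only the `ℓ` values on the right of the cut that depend on the left. -/
theorem Rule.IsConservative.flow_le {q ℓ r : ℕ} {f : Rule q (ℓ + r + 1)}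
    (hf : f.IsConservative) (c : Config q) (i : ℤ) : flow f c i ≤ ℓ * ((q - 1 : ℕ) : ℤ) := by
  let c₁ := trunc c (i - ℓ) (i + r)
  let c₂ := trunc c i (i + r)
  have e : ∀ j, i ≤ j → c₁ j = c₂ j := by
    intro j hj
    by_cases h : j < i + r
    · exact (trunc_of_mem c (by omega) h).trans (trunc_of_mem c hj h).symm
    · exact Fin.ext ((trunc_of_le c (by omega)).trans (trunc_of_le c (by omega)).symm)
  obtain ⟨M, ⟨m1, m2⟩, m3, m4⟩ := (((hf.leftSum_eq_flow (c := c) (finSupp_trunc c (i - ℓ) (i + r))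
    (fun j h1 h2 => trunc_of_mem c h1 h2)).and
    (hf.leftSum_add_rightSum ℓ (finSupp_trunc c (i - ℓ) (i + r)) i)).and
    ((hf.leftSum_add_rightSum ℓ (finSupp_trunc c i (i + r)) i).and
    (eventually_ge_atTop ℓ))).exists
  have hneg : leftSum f ℓ c₂ i M ≤ 0 := by
    refine Finset.sum_nonpos fun s _ => ?_
    rw [drift, trunc_of_lt _ (by omega)]
    omega
  have hdiff : rightSum f ℓ c₂ i M - rightSum f ℓ c₁ i M ≤ ℓ * ((q - 1 : ℕ) : ℤ) := by
    rw [rightSum, rightSum, ← Finset.sum_sub_distrib]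
    refine sum_range_le_of_vanish (fun s => ?_) (fun s hs => ?_) m4
    · have := toCA_sub_le f ℓ c₁ c₂ (i + s)
      rw [drift, drift, e _ (by omega)]
      omega
    · rw [drift, drift, e _ (by omega), toCA_congr f fun j h1 _ => e j (by omega), sub_self]
  simp only [c₁, c₂] at *
  omega

/-- The mirror image of `Rule.IsConservative.flow_le`: the cells on the right are emptied. -/
theorem Rule.IsConservative.le_flow {q ℓ r : ℕ} {f : Rule q (ℓ + r + 1)}
    (hf : f.IsConservative) (c : Config q) (i : ℤ) : -(r * ((q - 1 : ℕ) : ℤ)) ≤ flow f c i := by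
  let c₁ := trunc c (i - ℓ) (i + r)
  let c₂ := trunc c (i - ℓ) i
  have e : ∀ j, j < i → c₁ j = c₂ j := by
    intro j hj
    by_cases h : i - ℓ ≤ j
    · exact (trunc_of_mem c h (by omega)).trans (trunc_of_mem c h hj).symm
    · exact Fin.ext ((trunc_of_lt c (by omega)).trans (trunc_of_lt c (by omega)).symm)
  obtain ⟨M, m1, m3, m4⟩ := ((hf.leftSum_eq_flow (c := c) (finSupp_trunc c (i - ℓ) (i + r))
    (fun j h1 h2 => trunc_of_mem c h1 h2)).and
    ((hf.leftSum_add_rightSum ℓ (finSupp_trunc c (i - ℓ) i) i).and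
    (eventually_ge_atTop r))).exists
  have hneg : rightSum f ℓ c₂ i M ≤ 0 := by
    refine Finset.sum_nonpos fun s _ => ?_
    rw [drift, trunc_of_le _ (by omega)]
    omega
  have hdiff : leftSum f ℓ c₂ i M - leftSum f ℓ c₁ i M ≤ r * ((q - 1 : ℕ) : ℤ) := by
    rw [leftSum, leftSum, ← Finset.sum_sub_distrib]
    refine sum_range_le_of_vanish (fun s => ?_) (fun s hs => ?_) m4
    · have := toCA_sub_le f ℓ c₁ c₂ (i - 1 - s)
      rw [drift, drift, e _ (by omega)]
      omega
    · rw [drift, drift, e _ (by omega),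
        toCA_congr f fun j _ h1 => e j (by push_cast at h1; omega), sub_self]
  simp only [c₁, c₂] at *
  omega

/-! ### Necessity: blocked regions carry no flow -/

theorem PA.dest_mem {q : ℕ} {G : PA q} {c : Config q} {j i : ℤ} {k : Fin (c j : ℕ)}
    (h : G.dest c j k = some i) : j - G.L ≤ i ∧ i ≤ j + G.R := by
  simp only [PA.dest, Option.map_eq_some_iff] at h
  obtain ⟨z, -, rfl⟩ := h
  have := z.2.1
  have := z.2.2
  constructor <;> omega

theorem PA.dest_congr {q : ℕ} (G : PA q) {c c' : Config q} {j : ℤ}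
    (h : ∀ z, j - G.L ≤ z → z ≤ j + G.R → c z = c' z) (k : Fin (c j : ℕ)) :
    G.dest c j k = G.dest c' j (k.cast (by rw [h j (by omega) (by omega)])) := by
  have hmove : ∀ (s s' : Fin q) (u u' : Fin G.L → Fin q) (v v' : Fin G.R → Fin q)
      (hs : s = s') (_ : u = u') (_ : v = v') (k : Fin (s : ℕ)),
      G.move s u v k = G.move s' u' v' (k.cast (by rw [hs])) := by
    rintro s _ u _ v _ rfl rfl rfl k
    rfl
  simp only [PA.dest]
  congr 1
  refine hmove _ _ _ _ _ _ (h j (by omega) (by omega)) ?_ ?_ k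
  · funext m
    have := m.isLt
    exact h _ (by omega) (by omega)
  · funext m
    have := m.isLt
    exact h _ (by omega) (by omega)

theorem PA.finite_arrivals {q : ℕ} (G : PA q) (c : Config q) (i : ℤ) :
    (G.arrivals c i).Finite := by
  refine Set.Finite.subset (Finset.finite_toSet
    ((Finset.Icc (i - G.R) (i + G.L)).sigma fun _ => Finset.univ)) fun p hp => ?_
  have := PA.dest_mem hp
  simp only [coe_sigma, Set.mem_sigma_iff, coe_Icc, Set.mem_Icc]
  exact ⟨by omega, by simp⟩

/-- If all particles that arrive in `S` come from `T`, then `S` holds afterwards at most as many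
particles as `T` held before. -/
theorem PA.sum_act_le {q : ℕ} (G : PA q) (c : Config q) (S T : Finset ℤ)
    (h : ∀ i ∈ S, ∀ p ∈ G.arrivals c i, p.1 ∈ T) :
    ∑ i ∈ S, (G.act c i : ℕ) ≤ ∑ j ∈ T, (c j : ℕ) := by
  classical
  let P : Finset (Σ j : ℤ, Fin (c j : ℕ)) := T.sigma fun _ => Finset.univ
  have hP : P.card = ∑ j ∈ T, (c j : ℕ) := by simp [P, Finset.card_sigma]
  have hle : ∀ i ∈ S, (G.act c i : ℕ) ≤ (P.filter fun p => G.dest c p.1 p.2 = some i).card := by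
    intro i hi
    refine (min_le_right _ _).trans ?_
    rw [← Set.ncard_coe_finset]
    refine Set.ncard_le_ncard (fun p hp => ?_) (Finset.finite_toSet _)
    simp only [coe_filter, Set.mem_ofPred_eq, P, mem_sigma, mem_univ, and_true]
    exact ⟨h i hi p hp, hp⟩
  refine (Finset.sum_le_sum hle).trans ?_
  rw [← hP, ← Finset.card_biUnion]
  · exact Finset.card_le_card (Finset.biUnion_subset.2 fun i _ => Finset.filter_subset _ _)
  · intro i _ i' _ hne
    rw [Function.onFun, Finset.disjoint_left]
    intro p hp hp'
    have h1 := (mem_filter.1 hp).2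
    have h2 := (mem_filter.1 hp').2
    rw [h1] at h2
    exact hne (Option.some.inj h2)

/-- In a fixed configuration of empty and full cells no particle can move without anticipation. -/
theorem PA.eq_of_dest_eq_some {q : ℕ} (hq : 2 ≤ q) {G : PA q} (hG : ¬ G.Anticipates)
    {c : Config q} (hfix : G.act c = c) (hval : ∀ j, (c j : ℕ) = 0 ∨ (c j : ℕ) = q - 1)
    {j i : ℤ} {k : Fin (c j : ℕ)} (h : G.dest c j k = some i) : i = j := by
  by_contra hne
  rcases hval i with h0 | h1
  · have hact : (G.act c i : ℕ) = 0 := by rw [hfix, h0]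
    have hpos : 0 < (G.arrivals c i).ncard :=
      (Set.ncard_pos (G.finite_arrivals c i)).2 ⟨⟨j, k⟩, h⟩
    simp only [PA.act] at hact
    omega
  · refine hG ⟨c, i, ?_⟩
    have hpos : 0 < {p ∈ G.arrivals c i | p.1 ≠ i}.ncard :=
      (Set.ncard_pos ((G.finite_arrivals c i).subset fun p hp => hp.1)).2
        ⟨⟨j, k⟩, h, fun e => hne e.symm⟩
    omega

/-- Near a cut at which a finitely supported configuration looks like a fixed configuration of
empty and full cells, no particle crosses the cut; hence neither side loses any. -/
theorem IsProjection.leftSum_eq_zero {q n : ℕ} (hq : 2 ≤ q) {f : Rule q n}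
    (hf : f.IsConservative) {d : ℤ} {G : PA q} (hG : ¬ G.Anticipates)
    (hp : IsProjection (f.toCA d) G) {c' : Config q} (hfix : f.toCA d c' = c')
    (hval : ∀ j, (c' j : ℕ) = 0 ∨ (c' j : ℕ) = q - 1) {c : Config q} (hc : FinSupp c) {i : ℤ}
    (h : ∀ j, i - (G.L + G.R) ≤ j → j ≤ i + (G.L + G.R) → c j = c' j) :
    ∀ᶠ M in atTop, leftSum f d c i M = 0 := by
  have hcross : ∀ (j i' : ℤ) (k : Fin (c j : ℕ)), G.dest c j k = some i' → (j < i ↔ i' < i) := by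
    intro j i' k hk
    have hm := PA.dest_mem hk
    by_cases hnear : i - G.R ≤ j ∧ j ≤ i + G.L
    · rw [G.dest_congr (c' := c') (fun z h1 h2 => h z (by omega) (by omega))] at hk
      rw [PA.eq_of_dest_eq_some hq hG ((hp c').symm.trans hfix) hval hk]
    · omega
  have hsum := hf.leftSum_add_rightSum d hc i
  obtain ⟨K, hK⟩ := hc
  filter_upwards [hsum, eventually_ge_atTop (K + i.natAbs + 1)] with M hM hMK
  have hsupp : ∀ (j : ℤ) (_ : Fin (c j : ℕ)), i - M ≤ j ∧ j < i + M := by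
    intro j k
    by_contra hj
    have := hK j (by rw [le_abs]; omega)
    exact absurd k.isLt (by omega)
  -- Vanishing particles and the cut-off can only increase the losses, so that these are
  -- non-negative on both sides; their sum is zero.
  have hl : 0 ≤ leftSum f d c i M := by
    have hinj : Set.InjOn (fun s : ℕ => i - 1 - (s : ℤ)) (range M) := fun a _ b _ hab => by
      simp only at hab; omega
    have := G.sum_act_le c ((range M).image fun s : ℕ => i - 1 - (s : ℤ))
      ((range M).image fun s : ℕ => i - 1 - (s : ℤ)) (by
        intro i' hi' p hp'
        obtain ⟨s, hs, rfl⟩ := mem_image.1 hi'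
        have h1 := (hcross _ _ _ hp').2 (by omega)
        have h2 := hsupp p.1 p.2
        exact mem_image.2 ⟨(i - 1 - p.1).toNat, mem_range.2 (by omega), by omega⟩)
    rw [Finset.sum_image hinj, Finset.sum_image hinj] at this
    simp only [leftSum, drift, Finset.sum_sub_distrib, hp c]
    have h2 : (∑ s ∈ range M, ((G.act c (i - 1 - (s : ℤ)) : ℕ) : ℤ)) ≤
        ∑ s ∈ range M, ((c (i - 1 - (s : ℤ)) : ℕ) : ℤ) := by exact_mod_cast this
    omega
  have hr : 0 ≤ rightSum f d c i M := by
    have hinj : Set.InjOn (fun s : ℕ => i + (s : ℤ)) (range M) := fun a _ b _ hab => by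
      simp only at hab; omega
    have := G.sum_act_le c ((range M).image fun s : ℕ => i + (s : ℤ))
      ((range M).image fun s : ℕ => i + (s : ℤ)) (by
        intro i' hi' p hp'
        obtain ⟨s, hs, rfl⟩ := mem_image.1 hi'
        have h1 := (hcross _ _ _ hp').1
        have h2 := hsupp p.1 p.2
        have h3 : ¬ p.1 < i := fun h => absurd (h1 h) (by omega)
        exact mem_image.2 ⟨(p.1 - i).toNat, mem_range.2 (by omega), by omega⟩)
    rw [Finset.sum_image hinj, Finset.sum_image hinj] at this
    simp only [rightSum, drift, Finset.sum_sub_distrib, hp c]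
    have h2 : (∑ s ∈ range M, ((G.act c (i + (s : ℤ)) : ℕ) : ℤ)) ≤
        ∑ s ∈ range M, ((c (i + (s : ℤ)) : ℕ) : ℤ) := by exact_mod_cast this
    omega
  omega

/-- The offset is forced by the lack of flow in the interior of a long block of full cells. -/
theorem Rule.AvoidsAnticipation.offset_mul {q n : ℕ} (hq : 2 ≤ q) {f : Rule q n}
    (hf : f.IsConservative) {d : ℤ} (h : f.AvoidsAnticipation d) :
    d * ((q - 1 : ℕ) : ℤ) = ∑ s ∈ range (n - 1), (f (stepWord hq n (s + 1)) : ℤ) := by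
  obtain ⟨G, hG, hp⟩ := h
  have hn := hf.pos hq
  let m : Fin q := ⟨q - 1, by omega⟩
  -- After one step, the full block `{-K, …, K-1}` still covers, in the left half-line, the `K'`
  -- cells whose windows lie inside it; they are preceded by the values on the step words.
  let K' : ℕ := n + 2 * d.natAbs + G.L + G.R + 1
  obtain ⟨K, hK⟩ : ∃ K : ℕ, (K : ℤ) = K' + d := ⟨(K' + d).toNat, by simp only [K']; omega⟩
  have hK' : (K' : ℤ) = n + 2 * d.natAbs + G.L + G.R + 1 := by simp only [K']; push_cast; ring
  let c : Config q := trunc (fun _ => m) (-K) K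
  have hc1 : ∀ j : ℤ, -K ≤ j → j < K → c j = m := fun j h1 h2 => trunc_of_mem _ h1 h2
  have hc0 : ∀ j : ℤ, j < -K → (c j : ℕ) = 0 := fun j h1 => trunc_of_lt _ h1
  have hzero := IsProjection.leftSum_eq_zero hq hf hG hp (c' := fun _ => m)
    (funext fun i => hf.toCA_eq_of_const m fun _ _ _ => rfl) (fun _ => Or.inr rfl)
    (finSupp_trunc _ (-K) K) (i := 0) (fun j h1 h2 => hc1 j (by omega) (by omega))
  obtain ⟨M, hM, hMK⟩ := (hzero.and (eventually_ge_atTop (K + K' + n))).exists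
  simp only [leftSum, drift, Finset.sum_sub_distrib, sub_eq_zero] at hM
  have e1 : ∑ s ∈ range M, ((trunc (fun _ => m) (-K) K (0 - 1 - (s : ℤ)) : ℕ) : ℤ) =
      K * ((q - 1 : ℕ) : ℤ) := by
    obtain ⟨M', rfl⟩ := Nat.exists_eq_add_of_le (show K ≤ M by omega)
    rw [Finset.sum_range_add, Finset.sum_eq_zero (s := range M'), add_zero]
    · rw [Finset.sum_congr rfl (g := fun _ => ((q - 1 : ℕ) : ℤ))]
      · simp
      · intro s hs
        have := mem_range.1 hs
        exact congrArg (fun z : Fin q => ((z : ℕ) : ℤ)) (hc1 (0 - 1 - s) (by omega) (by omega))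
    · intro s _
      exact_mod_cast hc0 (0 - 1 - (K + s : ℕ)) (by push_cast; omega)
  have e2 : ∑ s ∈ range M, ((f.toCA d (trunc (fun _ => m) (-K) K) (0 - 1 - (s : ℤ)) : ℕ) : ℤ) =
      K' * ((q - 1 : ℕ) : ℤ) + ∑ s ∈ range (n - 1), (f (stepWord hq n (s + 1)) : ℤ) := by
    obtain ⟨M', rfl⟩ := Nat.exists_eq_add_of_le (show K' + (n - 1) ≤ M by omega)
    rw [Finset.sum_range_add, Finset.sum_eq_zero (s := range M'), add_zero, Finset.sum_range_add]
    · congr 1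
      · rw [Finset.sum_congr rfl (g := fun _ => ((q - 1 : ℕ) : ℤ))]
        · simp
        · intro s hs
          have := mem_range.1 hs
          rw [hf.toCA_eq_of_const m fun j h1 h2 => hc1 j (by omega) (by omega)]
      · refine Finset.sum_congr rfl fun s hs => ?_
        have := mem_range.1 hs
        simp only [Rule.toCA]
        congr 3
        funext k
        have := k.isLt
        simp only [window, stepWord]
        split
        · exact Fin.ext (hc0 _ (by push_cast; omega))
        · exact hc1 _ (by push_cast; omega) (by push_cast; omega)
    · intro s _
      have := hf.toCA_eq_zero (d := d) (c := c) (i := 0 - 1 - (K' + (n - 1) + s : ℕ))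
        fun j h1 h2 => hc0 j (by push_cast at h2; omega)
      exact_mod_cast this
  rw [e1, e2, hK] at hM
  linarith

/-- The number of particles that cell `j` receives in the transport that moves as many particles
as a particle automaton without anticipation possibly can. -/
def received {q n : ℕ} (f : Rule q n) (d : ℤ) (c : Config q) (j : ℤ) : ℕ :=
  min (f.toCA d c j : ℕ) (q - 1 - c j)

/-- The number of particles that cell `j` emits in the transport that moves as many particles
as a particle automaton without anticipation possibly can. -/
def emitted {q n : ℕ} (f : Rule q n) (d : ℤ) (c : Config q) (j : ℤ) : ℕ :=
  min (c j : ℕ) (q - 1 - f.toCA d c j)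

theorem Rule.IsConservative.sum_period {q n : ℕ} {f : Rule q n}
    (hf : f.IsConservative) {d : ℤ} {c : Config q} {p : ℕ} (hp : 0 < p)
    (hc : ∀ i : ℤ, c (i + (p : ℤ)) = c i) (z : ℤ) :
    ∑ k ∈ range p, (f.toCA d c ((k : ℤ) + z) : ℕ) = ∑ k ∈ range p, (c ((k : ℤ) + z) : ℕ) := by
  rw [sum_period_shift (fun z => (c z : ℕ)) p (fun z => by rw [hc]),
    sum_period_shift (fun z => (f.toCA d c z : ℕ)) p]
  · exact (Rule.isConservative_iff f d).2 hf c p hp hc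
  · intro i
    simp only [Rule.toCA]
    congr 2
    funext k
    simp only [window]
    rw [← hc (i - d + _)]
    congr 1
    ring

/-- Where no cell can receive a particle, no state increases; conservation excludes a decrease. -/
theorem Rule.IsConservative.fixed_of_received_eq_zero {q n : ℕ} {f : Rule q n}
    (hf : f.IsConservative) {d : ℤ} {c : Config q} {p : ℕ} (hp : 0 < p)
    (hc : ∀ i : ℤ, c (i + (p : ℤ)) = c i) (h : ∀ j, received f d c j = 0) :
    f.toCA d c = c ∧ ∀ j, (c j : ℕ) = 0 ∨ (c j : ℕ) = q - 1 := by
  have hle : ∀ j, (f.toCA d c j : ℕ) ≤ c j := by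
    intro j
    have := h j
    have := (f.toCA d c j).isLt
    simp only [received] at *
    omega
  have hfix : f.toCA d c = c := by
    funext z
    have := (Finset.sum_eq_sum_iff_of_le fun k _ => hle _).1 (hf.sum_period (d := d) hp hc z) 0
      (mem_range.2 hp)
    apply Fin.ext
    simpa using this
  refine ⟨hfix, fun j => ?_⟩
  have := h j
  have := (c j).isLt
  simp only [received, hfix] at *
  omega

/-- Where no cell can emit a particle, no state decreases; conservation excludes an increase. -/
theorem Rule.IsConservative.fixed_of_emitted_eq_zero {q n : ℕ} {f : Rule q n}
    (hf : f.IsConservative) {d : ℤ} {c : Config q} {p : ℕ} (hp : 0 < p)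
    (hc : ∀ i : ℤ, c (i + (p : ℤ)) = c i) (h : ∀ j, emitted f d c j = 0) :
    f.toCA d c = c ∧ ∀ j, (c j : ℕ) = 0 ∨ (c j : ℕ) = q - 1 := by
  have hle : ∀ j, (c j : ℕ) ≤ f.toCA d c j := by
    intro j
    have := h j
    have := (c j).isLt
    simp only [emitted] at *
    omega
  have hfix : f.toCA d c = c := by
    funext z
    have := (Finset.sum_eq_sum_iff_of_le fun k _ => hle _).1
      (hf.sum_period (d := d) hp hc z).symm 0 (mem_range.2 hp)
    apply Fin.ext
    simpa using this.symm
  refine ⟨hfix, fun j => ?_⟩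
  have := h j
  have := (c j).isLt
  simp only [emitted, hfix] at *
  omega

/-- The length `(t + 1) q ^ t`, where `t = 2 max {ℓ, r}`, beyond which a blocked region repeats
itself. -/
def blockLength (q ℓ r : ℕ) : ℕ := (2 * max ℓ r + 1) * q ^ (2 * max ℓ r)

/-- A local quantity `b` whose vanishing on a whole periodic configuration makes it a fixed one of
empty and full cells cannot vanish on a long region with non-zero flow: by the pigeonhole principle
a part of this region could be repeated periodically. -/
theorem Rule.AvoidsAnticipation.exists_ne_zero_or_flow_eq_zero {q ℓ r : ℕ} (hq : 2 ≤ q)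
    {f : Rule q (ℓ + r + 1)} (hf : f.IsConservative) (h : f.AvoidsAnticipation ℓ)
    (b : ℕ → ℕ → ℕ)
    (hb : ∀ (c : Config q) (p : ℕ), 0 < p → (∀ i : ℤ, c (i + (p : ℤ)) = c i) →
      (∀ j, b (c j) (f.toCA ℓ c j) = 0) →
        f.toCA ℓ c = c ∧ ∀ j, (c j : ℕ) = 0 ∨ (c j : ℕ) = q - 1)
    (c : Config q) (x : ℤ) :
    ∃ y : ℤ, x ≤ y ∧ y < x + blockLength q ℓ r ∧
      (b (c y) (f.toCA ℓ c y) ≠ 0 ∨ flow f c y = 0) := by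
  by_contra! hcon
  obtain ⟨G, hG, hp⟩ := h
  obtain ⟨t, ht⟩ : ∃ t : ℕ, t = 2 * max ℓ r := ⟨_, rfl⟩
  have htl : ℓ + r ≤ t := by omega
  -- The cuts are spaced by `t + 1`, more than the length of the windows around them, so that the
  -- repeated part is longer than the windows.
  obtain ⟨i₁, i₂, hlt, hw⟩ : ∃ i₁ i₂ : Fin (q ^ t + 1), i₁ < i₂ ∧
      window c (x + (t + 1 : ℕ) * (i₁ : ℕ) - ℓ) (ℓ + r) =
        window c (x + (t + 1 : ℕ) * (i₂ : ℕ) - ℓ) (ℓ + r) := by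
    obtain ⟨i₁, i₂, hne, hw⟩ := Fintype.exists_ne_map_eq_of_card_lt
      (fun i : Fin (q ^ t + 1) => window c (x + (t + 1 : ℕ) * (i : ℕ) - ℓ) (ℓ + r)) (by
        simp only [Fintype.card_fun, Fintype.card_fin]
        exact Nat.lt_succ_of_le (Nat.pow_le_pow_right (by omega) htl))
    rcases lt_or_gt_of_ne hne with h | h
    · exact ⟨i₁, i₂, h, hw⟩
    · exact ⟨i₂, i₁, h, hw.symm⟩
  obtain ⟨y, hy⟩ : ∃ y : ℤ, y = x + (t + 1 : ℕ) * (i₁ : ℕ) := ⟨_, rfl⟩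
  obtain ⟨p, hpp⟩ : ∃ p : ℕ, p = (t + 1) * ((i₂ : ℕ) - i₁) := ⟨_, rfl⟩
  have hlt' : (i₁ : ℕ) < i₂ := hlt
  have hpt : t + 1 ≤ p := by
    rw [hpp]
    exact Nat.le_mul_of_pos_right _ (by omega)
  have hyp : x + (t + 1 : ℕ) * (i₂ : ℕ) = y + p := by
    rw [hy, hpp]
    push_cast [hlt'.le]
    ring
  have hend : y + p ≤ x + blockLength q ℓ r := by
    rw [← hyp, blockLength, ← ht]
    have : (t + 1) * (i₂ : ℕ) ≤ (t + 1) * q ^ t := Nat.mul_le_mul_left _ (by omega)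
    have : (((t + 1) * (i₂ : ℕ) : ℕ) : ℤ) ≤ (((t + 1) * q ^ t : ℕ) : ℤ) := by exact_mod_cast this
    push_cast at this ⊢
    omega
  have hxy : x ≤ y := by
    rw [hy]
    exact le_add_of_nonneg_right (by positivity)
  rw [hyp, ← hy] at hw
  have hwin : ∀ z, y - ℓ ≤ z → z < y + r → c z = c (z + p) := by
    intro z h1 h2
    have := congrFun hw ⟨(z - (y - ℓ)).toNat, by omega⟩
    simp only [window] at this
    rw [show y - ℓ + ((z - (y - ℓ)).toNat : ℤ) = z by omega,
      show y + p - ℓ + ((z - (y - ℓ)).toNat : ℤ) = z + p by omega] at this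
    exact this
  let c' : Config q := fun z => c ((z - y) % (p : ℤ) + y)
  have hmul : ∀ z k : ℤ, c' (z + p * k) = c' z := by
    intro z k
    simp only [c']
    rw [show z + p * k - y = z - y + p * k by ring, Int.add_mul_emod_self_left]
  have hper : ∀ z : ℤ, c' (z + (p : ℤ)) = c' z := by
    intro z
    have := hmul z 1
    rwa [mul_one] at this
  have hin : ∀ z, y ≤ z → z < y + p → c' z = c z := by
    intro z h1 h2
    simp only [c']
    rw [Int.emod_eq_of_lt (by omega) (by omega), sub_add_cancel]
  have hnear : ∀ z, y - ℓ ≤ z → z < y + p + r → c' z = c z := by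
    intro z h1 h2
    by_cases h3 : z < y
    · rw [← hper, hin _ (by omega) (by omega), hwin z h1 (by omega)]
    · by_cases h4 : z < y + p
      · exact hin z (by omega) h4
      · have h5 := hper (z - p)
        have h6 := hwin (z - p) (by omega) (by omega)
        rw [sub_add_cancel] at h5 h6
        rw [h5, hin _ (by omega) (by omega), h6]
  have hF : ∀ z, y ≤ z → z < y + p → f.toCA ℓ c' z = f.toCA ℓ c z := fun z h1 h2 =>
    toCA_congr f fun j h3 h4 => hnear j (by omega) (by push_cast at h4; omega)
  have hzero : ∀ j, b (c' j) (f.toCA ℓ c' j) = 0 := by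
    intro j
    have h1 := Int.emod_nonneg (j - y) (b := p) (by omega)
    have h2 := Int.emod_lt_of_pos (j - y) (b := p) (by omega)
    have h3 := Int.emod_add_mul_ediv (j - y) p
    obtain ⟨w, hw⟩ : ∃ w, w = (j - y) % p + y := ⟨_, rfl⟩
    have hj : j = w + p * ((j - y) / p) := by rw [hw]; omega
    have e1 : c' j = c w := by
      rw [hj, hmul, hin w (by omega) (by omega)]
    have e2 : f.toCA ℓ c' j = f.toCA ℓ c w := by
      rw [← hF w (by omega) (by omega)]
      simp only [Rule.toCA]
      congr 1
      funext k
      simp only [window]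
      rw [← hmul (w - ℓ + _) ((j - y) / p)]
      congr 1
      omega
    rw [e1, e2]
    exact (hcon w (by omega) (by omega)).1
  obtain ⟨hfix, hval⟩ := hb c' p (by omega) hper hzero
  -- A finite piece of `c'` has at `y` both no flow, by the rigidity of `c'`, and the flow of `c`.
  let c₀ := trunc c' (y - (G.L + G.R) - ℓ) (y + (G.L + G.R) + r + 1)
  have hfs : FinSupp c₀ := finSupp_trunc _ _ _
  have h1 := IsProjection.leftSum_eq_zero hq hf hG hp hfix hval hfs (i := y)
    fun j h1 h2 => trunc_of_mem c' (by omega) (by omega)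
  have h2 := hf.leftSum_eq_flow hfs (c := c) (i := y) fun j h1 h2 =>
    (trunc_of_mem c' (by omega) (by omega)).trans (hnear j (by omega) (by omega))
  obtain ⟨M, h3, h4⟩ := (h1.and h2).exists
  exact (hcon y hxy (by omega)).2 (h4.symm.trans h3)

/-- Every long region contains a cell that can receive a particle, or a cut without flow; and
similarly for a cell that can emit a particle. -/
def Unblocked {q ℓ r : ℕ} (f : Rule q (ℓ + r + 1)) : Prop :=
  ∀ (c : Config q) (x : ℤ),
    (∃ y : ℤ, x ≤ y ∧ y < x + blockLength q ℓ r ∧ (received f ℓ c y ≠ 0 ∨ flow f c y = 0)) ∧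
    (∃ y : ℤ, x ≤ y ∧ y < x + blockLength q ℓ r ∧ (emitted f ℓ c y ≠ 0 ∨ flow f c y = 0))

theorem Rule.AvoidsAnticipation.unblocked {q ℓ r : ℕ} (hq : 2 ≤ q)
    {f : Rule q (ℓ + r + 1)} (hf : f.IsConservative) (h : f.AvoidsAnticipation ℓ) :
    Unblocked f := fun c x =>
  ⟨h.exists_ne_zero_or_flow_eq_zero hq hf (fun u v => min v (q - 1 - u))
    (fun _ _ hp hc hz => hf.fixed_of_received_eq_zero hp hc hz) c x,
  h.exists_ne_zero_or_flow_eq_zero hq hf (fun u v => min u (q - 1 - v))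
    (fun _ _ hp hc hz => hf.fixed_of_emitted_eq_zero hp hc hz) c x⟩

/-! ### Order-preserving transport -/

/-- Every function on `ℤ` is the difference function of a cumulative sum. -/
theorem exists_antidifference (g : ℤ → ℤ) : ∃ E : ℤ → ℤ, ∀ j, E (j + 1) = E j + g j := by
  refine ⟨fun y => ∑ s ∈ range y.toNat, g s - ∑ s ∈ range (-y).toNat, g (-1 - s), fun j => ?_⟩
  rcases Int.le_total 0 j with h | h
  · obtain ⟨n, rfl⟩ := Int.eq_ofNat_of_zero_le h
    have h1 : ((n : ℤ) + 1).toNat = n + 1 := by omega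
    have h2 : (-((n : ℤ) + 1)).toNat = 0 := by omega
    have h3 : (-(n : ℤ)).toNat = 0 := by omega
    simp only [h1, h2, h3, Int.toNat_natCast, Finset.sum_range_succ, Finset.range_zero,
      Finset.sum_empty]
    ring
  · rcases eq_or_lt_of_le h with rfl | h
    · simp
    · obtain ⟨n, hn⟩ : ∃ n : ℕ, j = -(n + 1 : ℤ) := ⟨(-j - 1).toNat, by omega⟩
      subst hn
      have h1 : (-(n + 1 : ℤ) + 1).toNat = 0 := by omega
      have h2 : (-(-(n + 1 : ℤ) + 1)).toNat = n := by omega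
      have h3 : (-(n + 1 : ℤ)).toNat = 0 := by omega
      have h4 : (-(-(n + 1 : ℤ))).toNat = n + 1 := by omega
      simp only [h1, h2, h3, h4, Finset.sum_range_succ, Finset.range_zero, Finset.sum_empty]
      rw [show (-1 - (n : ℤ)) = -(n + 1 : ℤ) by ring]
      ring

/-- In `s` consecutive blocks without a zero of `φ`, the function `A` grows by at least `s`. -/
theorem add_le_of_blocks {A φ : ℤ → ℤ} (hA : Monotone A) {N : ℕ}
    (hN : ∀ x : ℤ, ∃ y, x ≤ y ∧ y < x + N ∧ (A y < A (y + 1) ∨ φ y = 0)) (x : ℤ) (s : ℕ)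
    (h : ∀ y, x ≤ y → y < x + (s * N : ℕ) → φ y ≠ 0) : A x + s ≤ A (x + (s * N : ℕ)) := by
  induction s with
  | zero => simp
  | succ s ih =>
    have h1 := ih fun y h1 h2 => h y h1 (by push_cast at h2 ⊢; linarith)
    obtain ⟨y, h2, h3, h4⟩ := hN (x + (s * N : ℕ))
    have e : x + ((s + 1) * N : ℕ) = x + (s * N : ℕ) + N := by push_cast; ring
    have h5 := h4.resolve_right (h y (by omega) (by omega))
    have h6 := hA h2
    have h7 : A (y + 1) ≤ A (x + ((s + 1) * N : ℕ)) := hA (by omega)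
    push_cast at *
    omega

/-- Let `E` and `A` count the particles that are emitted and that arrive on the left of each cut,
in an order-preserving transport with flow `φ`. If no long region is blocked for arrivals, every
particle finds its destination within the distance that the bounds on the flow suggest: on its
way every block of `N` cells would absorb a particle. -/
theorem exists_destination {E A φ : ℤ → ℤ} (hE : Monotone E) (hA : Monotone A)
    (hφ : ∀ y, E y = A y + φ y) {N P Λ : ℕ} (hP : ∀ y, φ y ≤ P) (hΛ : ∀ y, -(Λ : ℤ) ≤ φ y)
    (hN : ∀ x : ℤ, ∃ y, x ≤ y ∧ y < x + N ∧ (A y < A (y + 1) ∨ φ y = 0)) {j κ : ℤ}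
    (h1 : E j ≤ κ) (h2 : κ < E (j + 1)) :
    ∃ i, j - (Λ * N : ℕ) ≤ i ∧ i ≤ j + (P * N : ℕ) ∧ A i ≤ κ ∧ κ < A (i + 1) := by
  by_contra! hcon
  by_cases hj : A j ≤ κ
  · have hall : ∀ s : ℕ, s ≤ P * N + 1 → A (j + s) ≤ κ := by
      intro s
      induction s with
      | zero => intro _; simpa using hj
      | succ s ih =>
        intro hs
        have := hcon (j + s) (by omega) (by omega) (ih (by omega))
        rwa [add_assoc] at this
    have hb := add_le_of_blocks hA hN (j + 1) P fun y h3 h4 => by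
      have h5 := hall (y - j).toNat (by omega)
      rw [show j + ((y - j).toNat : ℤ) = y by omega] at h5
      have h6 := hE h3
      have := hφ y
      omega
    have h7 := hall (P * N + 1) le_rfl
    rw [show j + ((P * N + 1 : ℕ) : ℤ) = j + 1 + (P * N : ℕ) by push_cast; ring] at h7
    have := hφ (j + 1)
    have := hP (j + 1)
    omega
  · have hall : ∀ s : ℕ, s ≤ Λ * N → κ < A (j - s) := by
      intro s
      induction s with
      | zero => intro _; simpa using hj
      | succ s ih =>
        intro hs
        by_contra! h3
        have h4 := hcon (j - (s + 1 : ℕ)) (by omega) (by omega) h3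
        rw [show j - ((s + 1 : ℕ) : ℤ) + 1 = j - s by push_cast; ring] at h4
        have := ih (by omega)
        omega
    have hb := add_le_of_blocks hA hN (j - (Λ * N : ℕ)) Λ fun y h3 h4 => by
      have h5 := hall (j - y).toNat (by omega)
      rw [show j - ((j - y).toNat : ℤ) = y by omega] at h5
      have h6 := hE (show y ≤ j by omega)
      have := hφ y
      omega
    rw [sub_add_cancel] at hb
    have h7 := hall (Λ * N) le_rfl
    have := hφ j
    have := hΛ j
    omega

/-- The position of the cell `i` with `A i ≤ κ < A (i + 1)`, found by counting instead of a
search. -/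
theorem sum_ite_le_eq {A : ℤ → ℤ} (hA : Monotone A) {κ y i : ℤ} {S : ℕ} (h1 : y ≤ i)
    (h2 : i ≤ y + S) (h3 : A i ≤ κ) (h4 : κ < A (i + 1)) :
    ((∑ s ∈ range S, if A (y + (s + 1 : ℕ)) ≤ κ then 1 else 0 : ℕ) : ℤ) = i - y := by
  have hiff : ∀ s : ℕ, A (y + (s + 1 : ℕ)) ≤ κ ↔ s < (i - y).toNat := by
    intro s
    constructor
    · intro h
      by_contra hs
      have := hA (show i + 1 ≤ y + (s + 1 : ℕ) by omega)
      omega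
    · intro h
      exact (hA (show y + (s + 1 : ℕ) ≤ i by omega)).trans h3
  simp only [hiff]
  have hfil : (range S).filter (· < (i - y).toNat) = range (i - y).toNat := by
    ext s
    simp only [mem_filter, mem_range]
    omega
  rw [Finset.sum_boole, hfil, card_range, Nat.cast_id]
  omega

/-! ### The flow in terms of word numbers -/

/-- The state of the central cell of the window with number `v`. -/
def winState (q r v : ℕ) : ℕ := v / q ^ r % q

/-- The number of particles that the central cell of the window with number `v` receives. -/
def winReceived (q r C v : ℕ) : ℕ := min (lookup q C v) (q - 1 - winState q r v)

/-- The number of particles that the central cell of the window with number `v` emits. -/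
def winEmitted (q r C v : ℕ) : ℕ := min (winState q r v) (q - 1 - lookup q C v)

/-- The number of particles in the window with number `v` that lie to the left of the central
cell. -/
def winBefore (q ℓ r v : ℕ) : ℕ := ∑ s ∈ range ℓ, v / q ^ (r + 1 + s) % q

/-- The number of particles that would be to the left of the central cell of the window with
number `v` after one time step, if there were no other particles than those in the window, with
the exception of its last cell. -/
def winAfter (q ℓ r C v : ℕ) : ℕ := ∑ s ∈ range (ℓ + r), lookup q C (v / q ^ (s + 1))

theorem winState_wnum {q : ℕ} (ℓ r : ℕ) (c : Config q) (i : ℤ) :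
    winState q r (wnum c (i - ℓ) (ℓ + r + 1)) = c i := by
  have := wnum_div_mod_one c (i - ℓ) ℓ r
  rwa [sub_add_cancel, show ℓ + 1 + r = ℓ + r + 1 by ring] at this

theorem winReceived_wnum {q ℓ r : ℕ} (f : Rule q (ℓ + r + 1)) (c : Config q) (i : ℤ) :
    winReceived q r f.code (wnum c (i - ℓ) (ℓ + r + 1)) = received f ℓ c i := by
  rw [winReceived, winState_wnum, lookup_wnum, received]

theorem winEmitted_wnum {q ℓ r : ℕ} (f : Rule q (ℓ + r + 1)) (c : Config q) (i : ℤ) :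
    winEmitted q r f.code (wnum c (i - ℓ) (ℓ + r + 1)) = emitted f ℓ c i := by
  rw [winEmitted, winState_wnum, lookup_wnum, emitted]

theorem wnum_eq_zero {q : ℕ} {c : Config q} {a : ℤ} {m : ℕ}
    (h : ∀ j, a ≤ j → j < a + m → (c j : ℕ) = 0) : wnum c a m = 0 := by
  rw [wnum, wordIndex]
  refine Finset.sum_eq_zero fun k _ => ?_
  rw [window, h _ (by omega) (by have := k.isLt; omega), mul_zero]

/-- The windows of the cells to the left of a cut, in a configuration that is empty outside the
window, have numbers obtained by omitting digits at the end of the number of the window. -/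
theorem flow_eq_winBefore_sub_winAfter {q ℓ r : ℕ} (f : Rule q (ℓ + r + 1)) (c : Config q)
    (i : ℤ) : flow f c i = (winBefore q ℓ r (wnum c (i - ℓ) (ℓ + r + 1)) : ℤ) -
      winAfter q ℓ r f.code (wnum c (i - ℓ) (ℓ + r + 1)) := by
  simp only [flow, leftSum, drift, Finset.sum_sub_distrib]
  congr 1
  · rw [Finset.sum_range_add, Finset.sum_eq_zero (s := range r), add_zero, winBefore]
    · push_cast
      refine Finset.sum_congr rfl fun s hs => ?_
      have := mem_range.1 hs
      have h := wnum_div_mod_one c (i - ℓ) (ℓ - 1 - s) (r + 1 + s)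
      rw [show ℓ - 1 - s + 1 + (r + 1 + s) = ℓ + r + 1 by omega,
        show i - ℓ + ((ℓ - 1 - s : ℕ) : ℤ) = i - 1 - s by omega] at h
      rw [trunc_of_mem c (by omega) (by omega)]
      exact_mod_cast h.symm
    · intro s _
      rw [trunc_of_lt _ (by push_cast; omega)]
      rfl
  · rw [winAfter]
    push_cast
    refine Finset.sum_congr rfl fun s hs => ?_
    have := mem_range.1 hs
    have h := wnum_div c (i - ℓ) (ℓ + r - s) (s + 1)
    rw [show ℓ + r - s + (s + 1) = ℓ + r + 1 by omega] at h
    have h' := wnum_add (trunc c (i - ℓ) (i + r)) (i - 1 - s - ℓ) (s + 1) (ℓ + r - s)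
    have hz : wnum (trunc c (i - ℓ) (i + r)) (i - 1 - s - ℓ) (s + 1) = 0 :=
      wnum_eq_zero fun j _ hj => trunc_of_lt c (by push_cast at hj; omega)
    have hc : wnum (trunc c (i - ℓ) (i + r)) (i - ℓ) (ℓ + r - s) =
        wnum c (i - ℓ) (ℓ + r - s) :=
      wnum_congr fun j h1 h2 => trunc_of_mem c h1 (by omega)
    rw [hz, zero_mul, zero_add,
      show i - 1 - s - ℓ + ((s + 1 : ℕ) : ℤ) = i - ℓ by push_cast; ring, hc,
      show s + 1 + (ℓ + r - s) = ℓ + r + 1 by omega] at h'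
    rw [← lookup_wnum, h', h]

/-! ### The particle automaton -/

/-- The number of the window of the `s`-th inner cell of a region of `S + 1` cells, where `x` is
the number of the word that consists of the region and its margins. -/
def regionWindow (q n S x s : ℕ) : ℕ := x / q ^ (S - s) % q ^ n

theorem regionWindow_wnum {q : ℕ} (ℓ r S : ℕ) (c : Config q) (y : ℤ) {s : ℕ} (hs : s ≤ S) :
    regionWindow q (ℓ + r + 1) S (wnum c (y - ℓ) (S + (ℓ + r + 1))) s =
      wnum c (y + s - ℓ) (ℓ + r + 1) := by
  have := wnum_div_mod c (y - ℓ) s (ℓ + r + 1) (S - s)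
  rw [show s + (ℓ + r + 1) + (S - s) = S + (ℓ + r + 1) by omega] at this
  rw [regionWindow, this]
  congr 1
  ring

/-- The number of particles received by the first `s` inner cells of a region. -/
def regionReceived (q ℓ r C S x s : ℕ) : ℕ :=
  ∑ s' ∈ range s, winReceived q r C (regionWindow q (ℓ + r + 1) S x s')

/-- The index, in the neighborhood, of the cell to which the `k`-th particle of a cell moves; `x` is
the number of the word in the neighborhood of this cell. Emitted particles and received particles
are ranked from left to right, with the ranks of the received ones counted from the left end of the
region of `L₁ + R₁ + 1` cells. The rank of the `k`-th emitted particle is then `k`, plus the flow at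
its cell, plus the number of particles received before its cell, and its destination is the last
cell of the region before which at most so many particles are received. The flow, as the
difference of `winBefore` and `winAfter`, is spread over both sides to stay within `ℕ`. -/
def transportTarget (q ℓ r C L₁ R₁ x k : ℕ) : ℕ :=
  if k < winEmitted q r C (regionWindow q (ℓ + r + 1) (L₁ + R₁) x L₁) then
    ℓ + ∑ s ∈ range (L₁ + R₁),
      if regionReceived q ℓ r C (L₁ + R₁) x (s + 1) +
          winAfter q ℓ r C (regionWindow q (ℓ + r + 1) (L₁ + R₁) x L₁) ≤
        k + winBefore q ℓ r (regionWindow q (ℓ + r + 1) (L₁ + R₁) x L₁) +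
          regionReceived q ℓ r C (L₁ + R₁) x L₁ then 1 else 0
  else L₁ + ℓ

theorem transportTarget_le (q ℓ r C L₁ R₁ x k : ℕ) :
    transportTarget q ℓ r C L₁ R₁ x k ≤ L₁ + ℓ + (R₁ + r) := by
  have : ∀ P : ℕ → Prop, ∀ [DecidablePred P],
      (∑ s ∈ range (L₁ + R₁), if P s then 1 else 0) ≤ L₁ + R₁ := by
    intro P _
    calc _ ≤ ∑ s ∈ range (L₁ + R₁), 1 := Finset.sum_le_sum fun s _ => by split <;> omega
      _ = L₁ + R₁ := by simp
  rw [transportTarget]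
  split
  · have := this fun s => regionReceived q ℓ r C (L₁ + R₁) x (s + 1) +
          winAfter q ℓ r C (regionWindow q (ℓ + r + 1) (L₁ + R₁) x L₁) ≤
        k + winBefore q ℓ r (regionWindow q (ℓ + r + 1) (L₁ + R₁) x L₁) +
          regionReceived q ℓ r C (L₁ + R₁) x L₁
    omega
  · omega

/-- The lookup table of the order-preserving transport. -/
def transportTable (q ℓ r C L₁ R₁ : ℕ) : List (List (Option ℕ)) :=
  (List.range (q ^ (L₁ + R₁ + (ℓ + r + 1)))).map fun x =>
    (List.range q).map fun k => some (transportTarget q ℓ r C L₁ R₁ x k)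

theorem getD_map_range {α : Type*} (g : ℕ → α) {n i : ℕ} (d : α) (h : i < n) :
    ((List.range n).map g).getD i d = g i := by
  simp [List.getD, h]

theorem dest_transportTable {q : ℕ} (ℓ r C L₁ R₁ : ℕ) (c : Config q) (j : ℤ)
    (k : Fin (c j : ℕ)) :
    (PA.ofTable q (L₁ + ℓ) (R₁ + r) (transportTable q ℓ r C L₁ R₁)).dest c j k =
      some (j - (L₁ + ℓ : ℕ) +
        transportTarget q ℓ r C L₁ R₁ (wnum c (j - L₁ - ℓ) (L₁ + R₁ + (ℓ + r + 1))) k) := by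
  have hx : wordIndex (window c (j - ((L₁ + ℓ : ℕ) : ℤ)) (L₁ + ℓ)) * q ^ (R₁ + r + 1) +
      (c j : ℕ) * q ^ (R₁ + r) + wordIndex (window c (j + 1) (R₁ + r)) =
      wnum c (j - L₁ - ℓ) (L₁ + R₁ + (ℓ + r + 1)) := by
    have h1 := wnum_add c (j - L₁ - ℓ) (L₁ + ℓ) (1 + (R₁ + r))
    rw [wnum_add c _ 1 (R₁ + r), wnum_one,
      show j - L₁ - ℓ + ((L₁ + ℓ : ℕ) : ℤ) = j by push_cast; ring,
      show L₁ + ℓ + (1 + (R₁ + r)) = L₁ + R₁ + (ℓ + r + 1) by ring,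
      show j - L₁ - ℓ = j - ((L₁ + ℓ : ℕ) : ℤ) by push_cast; ring] at h1
    rw [show j - L₁ - ℓ = j - ((L₁ + ℓ : ℕ) : ℤ) by push_cast; ring, h1]
    simp only [wnum, Nat.cast_one]
    ring
  have hlt := wnum_lt c (j - L₁ - ℓ) (L₁ + R₁ + (ℓ + r + 1))
  have hk : (k : ℕ) < q := k.isLt.trans (c j).isLt
  have hle := transportTarget_le q ℓ r C L₁ R₁
    (wnum c (j - L₁ - ℓ) (L₁ + R₁ + (ℓ + r + 1))) k
  simp only [PA.dest, PA.ofTable]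
  rw [hx]
  simp only [transportTable]
  rw [getD_map_range _ _ hlt, getD_map_range _ _ hk]
  simp only [Option.bind_some, hle, dif_pos, Option.map_some]
  congr 1
  ring

/-- In configuration `c`, a particle automaton realizes the order-preserving transport with
cumulative emission `E` and cumulative reception `A`. -/
structure IsTransport {q : ℕ} (G : PA q) (c : Config q) (e : ℤ → ℕ) (E A : ℤ → ℤ) : Prop where
  stay : ∀ (j : ℤ) (k : Fin (c j : ℕ)), e j ≤ k → G.dest c j k = some j
  move : ∀ (j : ℤ) (k : Fin (c j : ℕ)), (k : ℕ) < e j →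
    ∃ i, G.dest c j k = some i ∧ A i ≤ E j + (k : ℕ) ∧ E j + (k : ℕ) < A (i + 1)

/-- Ranking the emitted particles from left to right, by `E j + k`, puts those that arrive at cell
`i` in bijection with the ranks in `{A i, …, A (i + 1) - 1}`. -/
theorem IsTransport.ncard_arrivals {q : ℕ} {G : PA q} {c : Config q} {e a : ℤ → ℕ}
    {E A : ℤ → ℤ} (h : IsTransport G c e E A) (hE : ∀ j, E (j + 1) = E j + e j)
    (hA : ∀ j, A (j + 1) = A j + a j) (he : ∀ j, e j ≤ c j) (mE : Monotone E) (mA : Monotone A)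
    (hsurj : ∀ i κ : ℤ, A i ≤ κ → κ < A (i + 1) → ∃ j, E j ≤ κ ∧ κ < E (j + 1)) (i : ℤ) :
    (G.arrivals c i).ncard + e i = c i + a i ∧ {p ∈ G.arrivals c i | p.1 ≠ i}.ncard ≤ a i := by
  have huniq : ∀ {B : ℤ → ℤ}, Monotone B → ∀ {x y κ : ℤ}, B x ≤ κ → κ < B (x + 1) → B y ≤ κ →
      κ < B (y + 1) → x = y := by
    intro B mB x y κ h1 h2 h3 h4
    rcases lt_trichotomy x y with hlt | rfl | hlt
    · have := mB (show x + 1 ≤ y by omega)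
      omega
    · rfl
    · have := mB (show y + 1 ≤ x by omega)
      omega
  let movers : Set (Σ j : ℤ, Fin (c j : ℕ)) := {p ∈ G.arrivals c i | (p.2 : ℕ) < e p.1}
  let stayers : Set (Σ j : ℤ, Fin (c j : ℕ)) := {p | p.1 = i ∧ e p.1 ≤ (p.2 : ℕ)}
  have hmfin : movers.Finite := (G.finite_arrivals c i).subset fun p hp => hp.1
  have hunion : G.arrivals c i = movers ∪ stayers := by
    ext p
    constructor
    · intro hp
      by_cases hk : (p.2 : ℕ) < e p.1
      · exact Or.inl ⟨hp, hk⟩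
      · refine Or.inr ⟨?_, not_lt.1 hk⟩
        have h1 := h.stay p.1 p.2 (not_lt.1 hk)
        have h2 : G.dest c p.1 p.2 = some i := hp
        rw [h1] at h2
        exact Option.some.inj h2
    · rintro (hp | hp)
      · exact hp.1
      · obtain ⟨j, k⟩ := p
        obtain ⟨rfl, h2⟩ := hp
        exact h.stay _ k h2
  have hsfin : stayers.Finite :=
    (G.finite_arrivals c i).subset (by rw [hunion]; exact Set.subset_union_right)
  have hdisj : Disjoint movers stayers := by
    rw [Set.disjoint_left]
    intro p h1 h2
    exact absurd h1.2 (not_lt.2 h2.2)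
  have hmov : movers.ncard = a i := by
    have hinj : Set.InjOn (fun p : Σ j : ℤ, Fin (c j : ℕ) => E p.1 + ((p.2 : ℕ) : ℤ)) movers := by
      rintro ⟨j, k⟩ h1 ⟨j', k'⟩ h2 heq
      have h3 := h1.2
      have h4 := h2.2
      simp only at h3 h4 heq
      have h5 := hE j
      have h6 := hE j'
      obtain rfl : j = j' := huniq mE (κ := E j + ((k : ℕ) : ℤ)) (by omega) (by omega) (by omega)
        (by omega)
      obtain rfl : k = k' := Fin.ext (by omega)
      rfl
    have himg : (fun p : Σ j : ℤ, Fin (c j : ℕ) => E p.1 + ((p.2 : ℕ) : ℤ)) '' movers =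
        ↑(Finset.Ico (A i) (A (i + 1))) := by
      ext κ
      simp only [Set.mem_image, coe_Ico, Set.mem_Ico]
      constructor
      · rintro ⟨p, hp, rfl⟩
        obtain ⟨i', h1, h2, h3⟩ := h.move p.1 p.2 hp.2
        have h4 : G.dest c p.1 p.2 = some i := hp.1
        rw [h1] at h4
        obtain rfl := Option.some.inj h4
        exact ⟨h2, h3⟩
      · rintro ⟨h1, h2⟩
        obtain ⟨j, h3, h4⟩ := hsurj i κ h1 h2
        have h5 := hE j
        have h6 := he j
        have hk : (κ - E j).toNat < e j := by omega
        obtain ⟨i', h7, h8, h9⟩ := h.move j ⟨(κ - E j).toNat, by omega⟩ hk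
        have hcast : E j + ((κ - E j).toNat : ℤ) = κ := by omega
        simp only at h8 h9
        rw [hcast] at h8 h9
        obtain rfl := huniq mA h1 h2 h8 h9
        exact ⟨⟨j, ⟨(κ - E j).toNat, by omega⟩⟩, ⟨h7, hk⟩, hcast⟩
    rw [← hinj.ncard_image, himg, Set.ncard_coe_finset, Int.card_Ico, hA]
    omega
  have hstay : stayers.ncard = c i - e i := by
    have hinj : Set.InjOn (fun p : Σ j : ℤ, Fin (c j : ℕ) => (p.2 : ℕ)) stayers := by
      rintro ⟨j, k⟩ ⟨h1, -⟩ ⟨j', k'⟩ ⟨h2, -⟩ heq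
      simp only at h1 h2 heq
      subst h1
      subst h2
      obtain rfl : k = k' := Fin.ext heq
      rfl
    have himg : (fun p : Σ j : ℤ, Fin (c j : ℕ) => (p.2 : ℕ)) '' stayers =
        ↑(Finset.Ico (e i) (c i : ℕ)) := by
      ext k
      simp only [Set.mem_image, coe_Ico, Set.mem_Ico]
      constructor
      · rintro ⟨⟨j, k⟩, ⟨h1, h2⟩, rfl⟩
        simp only at h1 h2
        subst h1
        exact ⟨h2, k.isLt⟩
      · rintro ⟨h1, h2⟩
        exact ⟨⟨i, ⟨k, h2⟩⟩, ⟨rfl, h1⟩, rfl⟩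
    rw [← hinj.ncard_image, himg, Set.ncard_coe_finset, Nat.card_Ico]
  constructor
  · rw [hunion, Set.ncard_union_eq hdisj hmfin hsfin, hmov, hstay]
    have := he i
    omega
  · rw [← hmov]
    refine Set.ncard_le_ncard (fun p hp => ?_) hmfin
    have hp1 := hp.1
    rw [hunion] at hp1
    exact hp1.resolve_right fun hs => hp.2 hs.1

/-- The cumulative reception is the cumulative emission minus the flow. -/
theorem isTransport_transportTable {q ℓ r : ℕ} {f : Rule q (ℓ + r + 1)} (hf : f.IsConservative)
    (hu : Unblocked f) (c : Config q) :
    ∃ E A : ℤ → ℤ, (∀ j, E (j + 1) = E j + emitted f ℓ c j) ∧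
      (∀ j, A (j + 1) = A j + received f ℓ c j) ∧ Monotone E ∧ Monotone A ∧
      (∀ i κ : ℤ, A i ≤ κ → κ < A (i + 1) → ∃ j, E j ≤ κ ∧ κ < E (j + 1)) ∧
      IsTransport (PA.ofTable q (r * reach q ℓ r + ℓ) (ℓ * reach q ℓ r + r)
        (transportTable q ℓ r f.code (r * reach q ℓ r) (ℓ * reach q ℓ r))) c
        (emitted f ℓ c) E A := by
  obtain ⟨E, hE⟩ := exists_antidifference fun j => (emitted f ℓ c j : ℤ)
  obtain ⟨A, hAE⟩ : ∃ A : ℤ → ℤ, ∀ y, E y = A y + flow f c y :=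
    ⟨fun y => E y - flow f c y, fun y => by ring⟩
  have hA : ∀ j, A (j + 1) = A j + received f ℓ c j := by
    intro j
    have h1 := hf.flow_succ c j
    have h2 := hAE j
    have h3 := hAE (j + 1)
    have h4 := hE j
    have h5 := (c j).isLt
    have h6 := (f.toCA ℓ c j).isLt
    simp only [emitted, received] at *
    omega
  have mE : Monotone E := monotone_int_of_le_succ fun j => by have := hE j; omega
  have mA : Monotone A := monotone_int_of_le_succ fun j => by have := hA j; omega
  have hP : ∀ y, flow f c y ≤ (ℓ * (q - 1) : ℕ) := fun y => by
    have := hf.flow_le c y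
    push_cast
    exact this
  have hΛ : ∀ y, -((r * (q - 1) : ℕ) : ℤ) ≤ flow f c y := fun y => by
    have := hf.le_flow c y
    push_cast
    exact this
  have hreach : reach q ℓ r = (q - 1) * blockLength q ℓ r := by
    rw [reach, blockLength, mul_assoc]
  refine ⟨E, A, hE, hA, mE, mA, ?_, ?_, ?_⟩
  · -- Reversing the transport exchanges emission and reception and the sign of the flow.
    intro i κ h1 h2
    obtain ⟨j, -, -, h3⟩ := exists_destination (φ := fun y => -flow f c y) mA mE
      (fun y => by rw [hAE]; ring) (P := r * (q - 1)) (Λ := ℓ * (q - 1))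
      (N := blockLength q ℓ r) (fun y => by have := hΛ y; omega)
      (fun y => by have := hP y; omega) (fun x => by
        obtain ⟨y, h4, h5, h6⟩ := (hu c x).2
        refine ⟨y, h4, h5, ?_⟩
        have := hE y
        omega) h1 h2
    exact ⟨j, h3⟩
  all_goals
    obtain ⟨L₁, hL₁⟩ : ∃ L₁, L₁ = r * reach q ℓ r := ⟨_, rfl⟩
    obtain ⟨R₁, hR₁⟩ : ∃ R₁, R₁ = ℓ * reach q ℓ r := ⟨_, rfl⟩
    rw [← hL₁, ← hR₁]
    intro j k hk
    rw [dest_transportTable]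
    have hwin : ∀ s ≤ L₁ + R₁, regionWindow q (ℓ + r + 1) (L₁ + R₁)
        (wnum c (j - L₁ - ℓ) (L₁ + R₁ + (ℓ + r + 1))) s =
        wnum c (j - L₁ + s - ℓ) (ℓ + r + 1) :=
      fun s hs => regionWindow_wnum ℓ r (L₁ + R₁) c (j - L₁) hs
    have hmid := hwin L₁ (by omega)
    rw [sub_add_cancel] at hmid
    rw [transportTarget, hmid, winEmitted_wnum]
  · rw [if_neg (not_lt.2 hk), sub_add_cancel]
  · rw [if_pos hk]
    have hrec : ∀ s ≤ L₁ + R₁, (regionReceived q ℓ r f.code (L₁ + R₁)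
        (wnum c (j - L₁ - ℓ) (L₁ + R₁ + (ℓ + r + 1))) s : ℤ) = A (j - L₁ + s) - A (j - L₁) := by
      intro s
      induction s with
      | zero => intro _; simp [regionReceived]
      | succ s ih =>
        intro hs
        have h1 := ih (by omega)
        have h2 := hA (j - L₁ + s)
        rw [regionReceived, Finset.sum_range_succ, ← regionReceived, hwin s (by omega),
          winReceived_wnum]
        rw [Nat.cast_add, h1, Nat.cast_succ, ← add_assoc, h2]
        ring
    have hfl := flow_eq_winBefore_sub_winAfter f c j
    have hL := hrec L₁ (by omega)
    rw [sub_add_cancel] at hL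
    have hj := hAE j
    obtain ⟨i, h1, h2, h3, h4⟩ := exists_destination mE mA hAE hP hΛ (N := blockLength q ℓ r)
      (fun x => by
        obtain ⟨y, h4, h5, h6⟩ := (hu c x).1
        refine ⟨y, h4, h5, ?_⟩
        have := hA y
        omega) (j := j) (κ := E j + (k : ℕ)) (by omega) (by have := hE j; omega)
    rw [mul_assoc, ← hreach] at h1 h2
    rw [← hL₁] at h1
    rw [← hR₁] at h2
    have hsum := sum_ite_le_eq mA (S := L₁ + R₁) h1 (by push_cast; omega) h3 h4
    refine ⟨i, ?_, h3, h4⟩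
    rw [Finset.sum_congr rfl (g := fun s : ℕ =>
      if A (j - L₁ + (s + 1 : ℕ)) ≤ E j + (k : ℕ) then 1 else 0)]
    · congr 1
      push_cast at hsum ⊢
      rw [hsum]
      ring
    · intro s hs
      have h5 := hrec (s + 1) (by have := mem_range.1 hs; omega)
      congr 1
      apply propext
      omega

/-- Without long blocked regions, the order-preserving transport within the given distances is a
particle automaton without anticipation for the rule. -/
theorem Unblocked.transportTable_spec {q ℓ r : ℕ} {f : Rule q (ℓ + r + 1)}
    (hu : Unblocked f) (hf : f.IsConservative) :
    ¬ (PA.ofTable q (r * reach q ℓ r + ℓ) (ℓ * reach q ℓ r + r)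
      (transportTable q ℓ r f.code (r * reach q ℓ r) (ℓ * reach q ℓ r))).Anticipates ∧
    IsProjection (f.toCA ℓ) (PA.ofTable q (r * reach q ℓ r + ℓ) (ℓ * reach q ℓ r + r)
      (transportTable q ℓ r f.code (r * reach q ℓ r) (ℓ * reach q ℓ r))) := by
  have key : ∀ (c : Config q) (i : ℤ), ((PA.ofTable q (r * reach q ℓ r + ℓ)
      (ℓ * reach q ℓ r + r) (transportTable q ℓ r f.code (r * reach q ℓ r)
      (ℓ * reach q ℓ r))).arrivals c i).ncard + emitted f ℓ c i = c i + received f ℓ c i ∧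
      {p ∈ (PA.ofTable q (r * reach q ℓ r + ℓ) (ℓ * reach q ℓ r + r) (transportTable q ℓ r f.code
        (r * reach q ℓ r) (ℓ * reach q ℓ r))).arrivals c i | p.1 ≠ i}.ncard ≤
        received f ℓ c i := fun c i => by
    obtain ⟨E, A, hE, hA, mE, mA, hs, hT⟩ := isTransport_transportTable hf hu c
    exact hT.ncard_arrivals hE hA (fun j => min_le_left _ _) mE mA hs i
  constructor
  · rintro ⟨c, i, h⟩
    have h1 := (key c i).2
    have h2 := (c i).isLt
    simp only [received] at h1
    omega
  · intro c
    funext i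
    have h1 := (key c i).1
    have h2 := (c i).isLt
    have h3 := (f.toCA ℓ c i).isLt
    apply Fin.ext
    simp only [PA.act]
    simp only [received, emitted] at h1
    omega

/-! ### The criterion and the offset as arithmetical functions of the code -/

/-- The criterion `Unblocked` for a rule with code `C`, as a condition on the finitely many words
that cover a region of `blockLength q ℓ r` cells and its margins. -/
def Criterion (q ℓ r C : ℕ) : Prop :=
  ∀ x < q ^ (blockLength q ℓ r - 1 + (ℓ + r + 1)),
    (∃ s < blockLength q ℓ r,
      winReceived q r C (regionWindow q (ℓ + r + 1) (blockLength q ℓ r - 1) x s) ≠ 0 ∨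
      winBefore q ℓ r (regionWindow q (ℓ + r + 1) (blockLength q ℓ r - 1) x s) =
        winAfter q ℓ r C (regionWindow q (ℓ + r + 1) (blockLength q ℓ r - 1) x s)) ∧
    (∃ s < blockLength q ℓ r,
      winEmitted q r C (regionWindow q (ℓ + r + 1) (blockLength q ℓ r - 1) x s) ≠ 0 ∨
      winBefore q ℓ r (regionWindow q (ℓ + r + 1) (blockLength q ℓ r - 1) x s) =
        winAfter q ℓ r C (regionWindow q (ℓ + r + 1) (blockLength q ℓ r - 1) x s))

theorem criterion_iff_unblocked {q ℓ r : ℕ} (hq : 2 ≤ q) (f : Rule q (ℓ + r + 1)) :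
    Criterion q ℓ r f.code ↔ Unblocked f := by
  obtain ⟨S, hS⟩ : ∃ S, blockLength q ℓ r = S + 1 :=
    Nat.exists_eq_succ_of_ne_zero (by rw [blockLength]; positivity)
  have key : ∀ (c : Config q) (x : ℤ) (s : ℕ), s < S + 1 →
      winReceived q r f.code (regionWindow q (ℓ + r + 1) S
        (wnum c (x - ℓ) (S + (ℓ + r + 1))) s) = received f ℓ c (x + s) ∧
      winEmitted q r f.code (regionWindow q (ℓ + r + 1) S
        (wnum c (x - ℓ) (S + (ℓ + r + 1))) s) = emitted f ℓ c (x + s) ∧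
      (winBefore q ℓ r (regionWindow q (ℓ + r + 1) S (wnum c (x - ℓ) (S + (ℓ + r + 1))) s) =
        winAfter q ℓ r f.code (regionWindow q (ℓ + r + 1) S
          (wnum c (x - ℓ) (S + (ℓ + r + 1))) s) ↔ flow f c (x + s) = 0) := by
    intro c x s hs
    rw [regionWindow_wnum ℓ r S c x (by omega), winReceived_wnum, winEmitted_wnum,
      flow_eq_winBefore_sub_winAfter]
    exact ⟨rfl, rfl, by omega⟩
  rw [Criterion, Unblocked, hS, Nat.add_sub_cancel]
  constructor
  · intro h c x
    obtain ⟨⟨s, hs, h1⟩, ⟨s', hs', h2⟩⟩ := h _ (wnum_lt c (x - ℓ) (S + (ℓ + r + 1)))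
    obtain ⟨k1, -, k2⟩ := key c x s hs
    obtain ⟨-, k3, k4⟩ := key c x s' hs'
    rw [k1, k2] at h1
    rw [k3, k4] at h2
    exact ⟨⟨x + s, by omega, by omega, h1⟩, ⟨x + s', by omega, by omega, h2⟩⟩
  · intro h x hx
    obtain ⟨c, rfl⟩ := exists_wnum_eq (by omega) (0 - ℓ) hx
    obtain ⟨⟨y, hy1, hy2, hy3⟩, ⟨z, hz1, hz2, hz3⟩⟩ := h c 0
    lift y to ℕ using hy1
    lift z to ℕ using hz1
    obtain ⟨k1, -, k2⟩ := key c 0 y (by omega)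
    obtain ⟨-, k3, k4⟩ := key c 0 z (by omega)
    refine ⟨⟨y, by omega, ?_⟩, ⟨z, by omega, ?_⟩⟩
    · rw [k1, k2, zero_add]
      exact hy3
    · rw [k3, k4, zero_add]
      exact hz3

theorem wordIndex_stepWord {q : ℕ} (hq : 2 ≤ q) :
    ∀ {n i : ℕ}, i ≤ n → wordIndex (stepWord hq n i) = q ^ (n - i) - 1 := by
  intro n
  induction n with
  | zero => intro i hi; simp [wordIndex]
  | succ n ih =>
    intro i hi
    rw [wordIndex_succ]
    cases i with
    | zero =>
      have h : (fun k : Fin n => stepWord hq (n + 1) 0 k.succ) = stepWord hq n 0 := by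
        funext k
        simp [stepWord]
      rw [h, ih (by omega)]
      have h1 : 1 ≤ q ^ n := Nat.one_le_pow _ _ (by omega)
      obtain ⟨m, rfl⟩ := Nat.exists_eq_add_of_le hq
      simp only [stepWord, Nat.not_lt_zero, if_false, Nat.sub_zero, pow_succ]
      have h2 : 2 + m - 1 = m + 1 := by omega
      have h3 : (2 + m) ^ n * (2 + m) = (m + 1) * (2 + m) ^ n + (2 + m) ^ n := by ring
      rw [h2, h3]
      omega
    | succ i =>
      have h : (fun k : Fin n => stepWord hq (n + 1) (i + 1) k.succ) = stepWord hq n i := by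
        funext k
        simp [stepWord]
      rw [h, ih (by omega)]
      simp [stepWord]

/-- The only possible offset for the rule with code `C`. -/
def offset (q n C : ℕ) : ℕ := (∑ s ∈ range (n - 1), lookup q C (q ^ (s + 1) - 1)) / (q - 1)

theorem sum_lookup_eq {q n : ℕ} (hq : 2 ≤ q) (f : Rule q n) :
    ∑ s ∈ range (n - 1), lookup q f.code (q ^ (s + 1) - 1) =
      ∑ s ∈ range (n - 1), (f (stepWord hq n (s + 1)) : ℕ) := by
  rw [← Finset.sum_range_reflect]
  refine Finset.sum_congr rfl fun s hs => ?_
  have := mem_range.1 hs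
  rw [← lookup_code, wordIndex_stepWord hq (by omega)]
  congr 3
  omega

theorem offset_le {q n C : ℕ} (hq : 2 ≤ q) : offset q n C ≤ n - 1 := by
  refine Nat.div_le_of_le_mul ?_
  calc _ ≤ ∑ s ∈ range (n - 1), (q - 1) := Finset.sum_le_sum fun s _ => by
        have := lookup_lt (show 0 < q by omega) C (q ^ (s + 1) - 1)
        omega
    _ = (q - 1) * (n - 1) := by simp [mul_comm]

theorem Rule.AvoidsAnticipation.eq_offset {q n : ℕ} (hq : 2 ≤ q) {f : Rule q n}
    (hf : f.IsConservative) {d : ℤ} (h : f.AvoidsAnticipation d) : d = offset q n f.code := by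
  have h1 := h.offset_mul hq hf
  have h2 : d * ((q - 1 : ℕ) : ℤ) =
      ((∑ s ∈ range (n - 1), lookup q f.code (q ^ (s + 1) - 1) : ℕ) : ℤ) := by
    rw [h1, sum_lookup_eq hq]
    push_cast
    rfl
  rw [offset, Int.natCast_div, ← h2, Int.mul_ediv_cancel _ (by omega)]

theorem Rule.AvoidsAnticipation.eq_sum_div {q n : ℕ} (hq : 2 ≤ q) {f : Rule q n}
    (hf : f.IsConservative) {d : ℤ} (h : f.AvoidsAnticipation d) :
    (d : ℚ) = 1 / ((q : ℚ) - 1) * ∑ i ∈ Finset.Icc 1 (n - 1), ((f (stepWord hq n i) : ℕ) : ℚ) := by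
  have h1 := h.offset_mul hq hf
  have hn := hf.pos hq
  have hq1 : (q : ℚ) - 1 ≠ 0 := by
    have : (2 : ℚ) ≤ q := by exact_mod_cast hq
    linarith
  have h2 : Finset.Icc 1 (n - 1) = Finset.Ico 1 n := by
    ext i
    simp only [mem_Icc, mem_Ico]
    omega
  rw [h2, Finset.sum_Ico_eq_sum_range, one_div, eq_inv_mul_iff_mul_eq₀ hq1]
  have h3 : ((d * ((q - 1 : ℕ) : ℤ) : ℤ) : ℚ) =
      ((∑ s ∈ range (n - 1), (f (stepWord hq n (s + 1)) : ℤ) : ℤ) : ℚ) := by rw [h1]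
  rw [Nat.cast_sub (by omega)] at h3
  push_cast at h3
  rw [mul_comm, h3]
  exact Finset.sum_congr rfl fun s _ => by rw [add_comm]

theorem exists_avoidsAnticipation_iff {q n : ℕ} (hq : 2 ≤ q) {f : Rule q n}
    (hf : f.IsConservative) :
    (∃ d : ℤ, f.AvoidsAnticipation d) ↔
      Criterion q (offset q n f.code) (n - 1 - offset q n f.code) f.code := by
  have hn := hf.pos hq
  have hle := offset_le (n := n) (C := f.code) hq
  obtain ⟨ℓ, hℓ⟩ : ∃ ℓ, ℓ = offset q n f.code := ⟨_, rfl⟩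
  obtain ⟨r, hr⟩ : ∃ r, r = n - 1 - offset q n f.code := ⟨_, rfl⟩
  rw [← hr, ← hℓ]
  have hoff : ∀ d, f.AvoidsAnticipation d → d = (ℓ : ℤ) := fun d h => by
    rw [hℓ]
    exact h.eq_offset hq hf
  obtain rfl : n = ℓ + r + 1 := by omega
  rw [criterion_iff_unblocked hq]
  constructor
  · rintro ⟨d, h⟩
    obtain rfl := hoff d h
    exact h.unblocked hq hf
  · intro h
    exact ⟨ℓ, _, h.transportTable_spec hf⟩

/-! ### Computability -/

section Primrec

variable {α : Type*} [Primcodable α]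

theorem primrec_sum {h : α → ℕ} {g : α → ℕ → ℕ} (hh : Primrec h)
    (hg : Primrec fun p : α × ℕ => g p.1 p.2) : Primrec fun a => ∑ s ∈ range (h a), g a s := by
  have hstep : Primrec₂ fun (a : α) (p : ℕ × ℕ) => p.2 + g a p.1 :=
    Primrec.nat_add.comp (Primrec.snd.comp Primrec.snd)
      (hg.comp (Primrec.fst.pair (Primrec.fst.comp Primrec.snd)))
  refine (Primrec.nat_rec' hh (Primrec.const 0) hstep).of_eq fun a => ?_
  induction h a with
  | zero => rfl
  | succ m ih => rw [Finset.sum_range_succ, ← ih]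

theorem primrecPred_exists_lt {h : α → ℕ} {p : α → ℕ → Prop} (hh : Primrec h)
    (hp : PrimrecPred fun a : α × ℕ => p a.1 a.2) : PrimrecPred fun a => ∃ s < h a, p a s := by
  have hR : PrimrecRel fun (s : ℕ) (a : α) => p a s := hp.comp (Primrec.snd.pair Primrec.fst)
  exact (hR.exists_mem_list.comp (Primrec.list_range.comp hh) Primrec.id).of_eq (by simp)

theorem primrecPred_forall_lt {h : α → ℕ} {p : α → ℕ → Prop} (hh : Primrec h)
    (hp : PrimrecPred fun a : α × ℕ => p a.1 a.2) : PrimrecPred fun a => ∀ s < h a, p a s := by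
  have hR : PrimrecRel fun (s : ℕ) (a : α) => p a s := hp.comp (Primrec.snd.pair Primrec.fst)
  exact (hR.forall_mem_list.comp (Primrec.list_range.comp hh) Primrec.id).of_eq (by simp)

variable {q ℓ r n C v x s k L₁ R₁ S : α → ℕ}

theorem primrec_pow (hq : Primrec q) (hn : Primrec n) : Primrec fun a => q a ^ n a :=
  (Primrec₂.unpaired'.1 Nat.Primrec.pow).comp hq hn

theorem primrec_digit (hq : Primrec q) (hx : Primrec x) (hk : Primrec k) :
    Primrec fun a => x a / q a ^ k a % q a :=
  Primrec.nat_mod.comp (Primrec.nat_div.comp hx (primrec_pow hq hk)) hq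

theorem primrec_lookup (hq : Primrec q) (hC : Primrec C) (hv : Primrec v) :
    Primrec fun a => lookup (q a) (C a) (v a) := primrec_digit hq hC hv

theorem primrec_pred (hn : Primrec n) : Primrec fun a => n a - 1 :=
  Primrec.nat_sub.comp hn (Primrec.const 1)

theorem primrec_succ (hn : Primrec n) : Primrec fun a => n a + 1 :=
  Primrec.nat_add.comp hn (Primrec.const 1)

theorem primrec_winState (hq : Primrec q) (hr : Primrec r) (hv : Primrec v) :
    Primrec fun a => winState (q a) (r a) (v a) := primrec_digit hq hv hr

theorem primrec_winReceived (hq : Primrec q) (hr : Primrec r) (hC : Primrec C) (hv : Primrec v) :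
    Primrec fun a => winReceived (q a) (r a) (C a) (v a) :=
  Primrec.nat_min.comp (primrec_lookup hq hC hv)
    (Primrec.nat_sub.comp (primrec_pred hq) (primrec_winState hq hr hv))

theorem primrec_winEmitted (hq : Primrec q) (hr : Primrec r) (hC : Primrec C) (hv : Primrec v) :
    Primrec fun a => winEmitted (q a) (r a) (C a) (v a) :=
  Primrec.nat_min.comp (primrec_winState hq hr hv)
    (Primrec.nat_sub.comp (primrec_pred hq) (primrec_lookup hq hC hv))

theorem primrec_winBefore (hq : Primrec q) (hℓ : Primrec ℓ) (hr : Primrec r) (hv : Primrec v) :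
    Primrec fun a => winBefore (q a) (ℓ a) (r a) (v a) :=
  primrec_sum hℓ (primrec_digit (hq.comp Primrec.fst) (hv.comp Primrec.fst)
    (Primrec.nat_add.comp (primrec_succ (hr.comp Primrec.fst)) Primrec.snd))

theorem primrec_winAfter (hq : Primrec q) (hℓ : Primrec ℓ) (hr : Primrec r) (hC : Primrec C)
    (hv : Primrec v) : Primrec fun a => winAfter (q a) (ℓ a) (r a) (C a) (v a) :=
  primrec_sum (Primrec.nat_add.comp hℓ hr) (primrec_lookup (hq.comp Primrec.fst)
    (hC.comp Primrec.fst) (Primrec.nat_div.comp (hv.comp Primrec.fst)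
      (primrec_pow (hq.comp Primrec.fst) (primrec_succ Primrec.snd))))

theorem primrec_regionWindow (hq : Primrec q) (hn : Primrec n) (hS : Primrec S) (hx : Primrec x)
    (hs : Primrec s) : Primrec fun a => regionWindow (q a) (n a) (S a) (x a) (s a) :=
  Primrec.nat_mod.comp (Primrec.nat_div.comp hx (primrec_pow hq (Primrec.nat_sub.comp hS hs)))
    (primrec_pow hq hn)

theorem primrec_width (hℓ : Primrec ℓ) (hr : Primrec r) : Primrec fun a => ℓ a + r a + 1 :=
  primrec_succ (Primrec.nat_add.comp hℓ hr)

theorem primrec_regionReceived (hq : Primrec q) (hℓ : Primrec ℓ) (hr : Primrec r) (hC : Primrec C)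
    (hS : Primrec S) (hx : Primrec x) (hs : Primrec s) :
    Primrec fun a => regionReceived (q a) (ℓ a) (r a) (C a) (S a) (x a) (s a) :=
  primrec_sum hs (primrec_winReceived (hq.comp Primrec.fst) (hr.comp Primrec.fst)
    (hC.comp Primrec.fst) (primrec_regionWindow (hq.comp Primrec.fst)
      ((primrec_width hℓ hr).comp Primrec.fst) (hS.comp Primrec.fst) (hx.comp Primrec.fst)
      Primrec.snd))

theorem primrec_transportTarget (hq : Primrec q) (hℓ : Primrec ℓ) (hr : Primrec r)
    (hC : Primrec C) (hL₁ : Primrec L₁) (hR₁ : Primrec R₁) (hx : Primrec x) (hk : Primrec k) :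
    Primrec fun a => transportTarget (q a) (ℓ a) (r a) (C a) (L₁ a) (R₁ a) (x a) (k a) := by
  have hS : Primrec fun a => L₁ a + R₁ a := Primrec.nat_add.comp hL₁ hR₁
  have hv := primrec_regionWindow hq (primrec_width hℓ hr) hS hx hL₁
  refine Primrec.ite (Primrec.nat_lt.comp hk (primrec_winEmitted hq hr hC hv))
    (Primrec.nat_add.comp hℓ (primrec_sum hS (Primrec.ite (Primrec.nat_le.comp
      (Primrec.nat_add.comp ?_ ((primrec_winAfter hq hℓ hr hC hv).comp Primrec.fst)) ?_)
      (Primrec.const 1) (Primrec.const 0)))) (Primrec.nat_add.comp hL₁ hℓ)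
  · exact primrec_regionReceived (hq.comp Primrec.fst) (hℓ.comp Primrec.fst)
      (hr.comp Primrec.fst) (hC.comp Primrec.fst) (hS.comp Primrec.fst) (hx.comp Primrec.fst)
      (primrec_succ Primrec.snd)
  · exact (Primrec.nat_add.comp (Primrec.nat_add.comp hk (primrec_winBefore hq hℓ hr hv))
      (primrec_regionReceived hq hℓ hr hC hS hx hL₁)).comp Primrec.fst

theorem primrec_transportTable (hq : Primrec q) (hℓ : Primrec ℓ) (hr : Primrec r)
    (hC : Primrec C) (hL₁ : Primrec L₁) (hR₁ : Primrec R₁) :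
    Primrec fun a => transportTable (q a) (ℓ a) (r a) (C a) (L₁ a) (R₁ a) := by
  have fst₂ : Primrec fun p : (α × ℕ) × ℕ => p.1.1 := Primrec.fst.comp Primrec.fst
  refine Primrec.list_map (Primrec.list_range.comp (primrec_pow hq
    (Primrec.nat_add.comp (Primrec.nat_add.comp hL₁ hR₁) (primrec_width hℓ hr)))) ?_
  refine Primrec.list_map (Primrec.list_range.comp (hq.comp Primrec.fst)) ?_
  exact Primrec.option_some.comp (primrec_transportTarget (hq.comp fst₂) (hℓ.comp fst₂)
    (hr.comp fst₂) (hC.comp fst₂) (hL₁.comp fst₂) (hR₁.comp fst₂)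
    (Primrec.snd.comp Primrec.fst) Primrec.snd)

theorem primrec_blockLength (hq : Primrec q) (hℓ : Primrec ℓ) (hr : Primrec r) :
    Primrec fun a => blockLength (q a) (ℓ a) (r a) :=
  have ht : Primrec fun a => 2 * max (ℓ a) (r a) :=
    Primrec.nat_double.comp (Primrec.nat_max.comp hℓ hr)
  Primrec.nat_mul.comp (primrec_succ ht) (primrec_pow hq ht)

theorem primrec_reach (hq : Primrec q) (hℓ : Primrec ℓ) (hr : Primrec r) :
    Primrec fun a => reach (q a) (ℓ a) (r a) :=
  have ht : Primrec fun a => 2 * max (ℓ a) (r a) :=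
    Primrec.nat_double.comp (Primrec.nat_max.comp hℓ hr)
  Primrec.nat_mul.comp (Primrec.nat_mul.comp (primrec_pred hq) (primrec_succ ht))
    (primrec_pow hq ht)

theorem primrec_offset (hq : Primrec q) (hn : Primrec n) (hC : Primrec C) :
    Primrec fun a => offset (q a) (n a) (C a) :=
  Primrec.nat_div.comp (primrec_sum (primrec_pred hn) (primrec_lookup (hq.comp Primrec.fst)
    (hC.comp Primrec.fst) (primrec_pred (primrec_pow (hq.comp Primrec.fst)
      (primrec_succ Primrec.snd))))) (primrec_pred hq)

theorem primrecPred_criterion (hq : Primrec q) (hℓ : Primrec ℓ) (hr : Primrec r)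
    (hC : Primrec C) : PrimrecPred fun a => Criterion (q a) (ℓ a) (r a) (C a) := by
  have hN := primrec_blockLength hq hℓ hr
  have fst₂ : Primrec fun p : (α × ℕ) × ℕ => p.1.1 := Primrec.fst.comp Primrec.fst
  have hv : Primrec fun p : (α × ℕ) × ℕ => regionWindow (q p.1.1) (ℓ p.1.1 + r p.1.1 + 1)
      (blockLength (q p.1.1) (ℓ p.1.1) (r p.1.1) - 1) p.1.2 p.2 :=
    primrec_regionWindow (hq.comp fst₂) ((primrec_width hℓ hr).comp fst₂)
      ((primrec_pred hN).comp fst₂) (Primrec.snd.comp Primrec.fst) Primrec.snd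
  have hflow := Primrec.eq.comp (primrec_winBefore (hq.comp fst₂) (hℓ.comp fst₂) (hr.comp fst₂) hv)
    (primrec_winAfter (hq.comp fst₂) (hℓ.comp fst₂) (hr.comp fst₂) (hC.comp fst₂) hv)
  refine primrecPred_forall_lt (primrec_pow hq (Primrec.nat_add.comp (primrec_pred hN)
    (primrec_width hℓ hr))) (PrimrecPred.and
      (primrecPred_exists_lt (hN.comp Primrec.fst) (PrimrecPred.or (PrimrecPred.not
        (Primrec.eq.comp ?_ (Primrec.const 0))) hflow))
      (primrecPred_exists_lt (hN.comp Primrec.fst) (PrimrecPred.or (PrimrecPred.not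
        (Primrec.eq.comp ?_ (Primrec.const 0))) hflow)))
  · exact primrec_winReceived (hq.comp fst₂) (hr.comp fst₂) (hC.comp fst₂) hv
  · exact primrec_winEmitted (hq.comp fst₂) (hr.comp fst₂) (hC.comp fst₂) hv

end Primrec

theorem exists_computable_decider : ∃ decider : ℕ × ℕ × ℕ → Bool, Computable decider ∧
    ∀ (q n : ℕ), 2 ≤ q → ∀ f : Rule q n, f.IsConservative →
      (decider (q, n, f.code) = true ↔ ∃ d : ℤ, f.AvoidsAnticipation d) := by
  have hq : Primrec fun p : ℕ × ℕ × ℕ => p.1 := Primrec.fst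
  have hn : Primrec fun p : ℕ × ℕ × ℕ => p.2.1 := Primrec.fst.comp Primrec.snd
  have hC : Primrec fun p : ℕ × ℕ × ℕ => p.2.2 := Primrec.snd.comp Primrec.snd
  have hℓ := primrec_offset hq hn hC
  obtain ⟨_, h⟩ := primrecPred_criterion hq hℓ (Primrec.nat_sub.comp (primrec_pred hn) hℓ) hC
  refine ⟨_, h.to_comp, fun q n hq f hf => ?_⟩
  rw [exists_avoidsAnticipation_iff hq hf, decide_eq_true_iff]

theorem exists_computable_construction :
    ∃ construct : ℕ × ℕ × ℕ → ℕ × ℕ × ℕ × List (List (Option ℕ)), Computable construct ∧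
      ∀ (q n : ℕ), 2 ≤ q → ∀ f : Rule q n, f.IsConservative →
        ∀ d : ℤ, f.AvoidsAnticipation d →
          ∃ (ℓ r L R : ℕ) (T : List (List (Option ℕ))),
            d = (ℓ : ℤ) ∧ ℓ + r + 1 = n ∧
            L = r * reach q ℓ r + ℓ ∧ R = ℓ * reach q ℓ r + r ∧
            construct (q, n, f.code) = (ℓ, L, R, T) ∧
            ¬ (PA.ofTable q L R T).Anticipates ∧
            IsProjection (f.toCA d) (PA.ofTable q L R T) := by
  have hq : Primrec fun p : ℕ × ℕ × ℕ => p.1 := Primrec.fst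
  have hn : Primrec fun p : ℕ × ℕ × ℕ => p.2.1 := Primrec.fst.comp Primrec.snd
  have hC : Primrec fun p : ℕ × ℕ × ℕ => p.2.2 := Primrec.snd.comp Primrec.snd
  have hℓ := primrec_offset hq hn hC
  have hr := Primrec.nat_sub.comp (primrec_pred hn) hℓ
  have hreach := primrec_reach hq hℓ hr
  have hL₁ := Primrec.nat_mul.comp hr hreach
  have hR₁ := Primrec.nat_mul.comp hℓ hreach
  refine ⟨_, (hℓ.pair ((Primrec.nat_add.comp hL₁ hℓ).pair ((Primrec.nat_add.comp hR₁ hr).pair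
    (primrec_transportTable hq hℓ hr hC hL₁ hR₁)))).to_comp, fun q n hq f hf d hd => ?_⟩
  have hpos := hf.pos hq
  have hle := offset_le (n := n) (C := f.code) hq
  have hd' := hd.eq_offset hq hf
  obtain ⟨ℓ, hℓ⟩ : ∃ ℓ, ℓ = offset q n f.code := ⟨_, rfl⟩
  obtain ⟨r, hr⟩ : ∃ r, r = n - 1 - offset q n f.code := ⟨_, rfl⟩
  simp only [← hℓ] at *
  obtain rfl : n = ℓ + r + 1 := by omega
  subst hd'
  refine ⟨ℓ, r, _, _, _, rfl, rfl, rfl, rfl, ?_, (hd.unblocked hq hf).transportTable_spec hf⟩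
  simp only [← hr]

end ParticleCA

theorem mainTheorem4 :
    -- the offset is forced
    (∀ (q n : ℕ) (hq : 2 ≤ q) (f : ParticleCA.Rule q n), f.IsConservative →
      ∀ d : ℤ, f.AvoidsAnticipation d →
        (d : ℚ) = 1 / ((q : ℚ) - 1) *
          ∑ i ∈ Finset.Icc 1 (n - 1), ((f (ParticleCA.stepWord hq n i) : ℕ) : ℚ)) ∧
    -- the existence of an offset is decidable
    (∃ decider : ℕ × ℕ × ℕ → Bool, Computable decider ∧
      ∀ (q n : ℕ), 2 ≤ q → ∀ f : ParticleCA.Rule q n, f.IsConservative →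
        (decider (q, n, f.code) = true ↔ ∃ d : ℤ, f.AvoidsAnticipation d)) ∧
    -- offset, neighborhood and table of a suitable particle automaton can be computed
    (∃ construct : ℕ × ℕ × ℕ → ℕ × ℕ × ℕ × List (List (Option ℕ)), Computable construct ∧
      ∀ (q n : ℕ), 2 ≤ q → ∀ f : ParticleCA.Rule q n, f.IsConservative →
        ∀ d : ℤ, f.AvoidsAnticipation d →
          ∃ (ℓ r L R : ℕ) (T : List (List (Option ℕ))),
            d = (ℓ : ℤ) ∧ ℓ + r + 1 = n ∧
            L = r * ParticleCA.reach q ℓ r + ℓ ∧ R = ℓ * ParticleCA.reach q ℓ r + r ∧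
            construct (q, n, f.code) = (ℓ, L, R, T) ∧
            ¬ (ParticleCA.PA.ofTable q L R T).Anticipates ∧
            ParticleCA.IsProjection (f.toCA d) (ParticleCA.PA.ofTable q L R T)) := by
  exact ⟨fun _ _ hq _ hf _ h => h.eq_sum_div hq hf, ParticleCA.exists_computable_decider,
    ParticleCA.exists_computable_construction⟩
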